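/- Let $V=\bigcup_{n\in\omega}V_n$ be the superstructure over the set $V_0=\mathbb N$ of urelements ($V_{n+1}=V_n\cup\mathcal P(V_n)$), and let ${}^*V$ be a nonstandard universe: the truncation, at ${}^*\!\in$-rank $\omega$, of an elementary extension of $(V,\in)$ with ${}^*\mathbb N\setminus\mathbb N\neq\emptyset$. Let $H\in{}^*\mathbb N\setminus\mathbb N$ and $\Omega=\{1,2,\dots,H\}$, let ${}^*\mathcal P(\Omega)$ be the set of all internal subsets of $\Omega$, and let $(\Omega,\Sigma,L_P)$ be the hyperfinite Loeb space on $\Omega$, that is, the complete probability space generated by the standard parts of the internal probabilities $P(A)={}^*|A|/H$, $A\in{}^*\mathcal P(\Omega)$. Let $\nu_\omega$ be the completed fair coin tossing measure on ${}^\omega2$. A tree here is a set $T\subseteq{}^{<\omega}2$ which is closed under initial segments and has no maximal node, and $[T]\subseteq{}^\omega2$ is the set of its branches. For cardinals $\kappa,\lambda$, a $(\kappa,\lambda)$-witness is a sequence of trees $\langle T_{\alpha,n}:\alpha\in\lambda,\ n\in\omega\rangle$ such that (1) $\nu_\omega([T_{\alpha,n}])>\frac{n}{n+1}$ for all $\alpha\in\lambda$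 and $n\in\omega$, and (2) $|\{\alpha\in\lambda:\exists n\ (f\in[T_{\alpha,n}])\}|<\kappa$ for every $f\in{}^\omega2$. A probability space $(X,\Sigma,P)$ is called compact if there is a family $\mathcal C\subseteq\Sigma$ such that every $\mathcal D\subseteq\mathcal C$ with the finite intersection property has $\bigcap\mathcal D\ne\emptyset$, and such that $P(A)=\sup\{P(C):C\in\mathcal C,\ C\subseteq A\}$ for every $A\in\Sigma$. **Theorem 2.** Suppose that there exists a $(\kappa,\lambda)$-witness for some uncountable cardinals $\kappa$ and $\lambda$, that ${}^*V$ is $\kappa$-saturated (every family of fewer than $\kappa$ internal sets with the finite intersection property has nonempty intersection), and that $|{}^*\mathcal P(\Omega)|=\lambda$. Then the hyperfinite Loeb space $(\Omega,\Sigma,L_P)$ is compact. -/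

import Mathlib

universe u

open Cardinal MeasureTheory
open scoped ENNReal FirstOrder

/-! ### The language of set theory -/

/-- The only non-logical symbol is a binary relation symbol. -/
inductive MemSymbol : ℕ → Type
  | mem : MemSymbol 2

/-- The first-order language with one binary relation symbol (membership). -/
def setLang : FirstOrder.Language := ⟨fun _ => Empty, MemSymbol⟩

/-- Membership in a structure for the language of set theory. -/
def Elem {M : Type*} [setLang.Structure M] (x y : M) : Prop :=
  FirstOrder.Language.Structure.RelMap (L := setLang) MemSymbol.mem ![x, y]

/-- `p` is the (Kuratowski) ordered pair `{{x}, {x, y}}`. -/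
def IsPair {M : Type*} [setLang.Structure M] (p x y : M) : Prop :=
  ∃ a b : M, (∀ z, Elem z a ↔ z = x) ∧ (∀ z, Elem z b ↔ z = x ∨ z = y) ∧
    ∀ z, Elem z p ↔ z = a ∨ z = b

/-! ### The standard universe: the superstructure over `ℕ` (as a set of urelements) -/

/-- `Stage n` is the set `V_n`, where `V_0 = ℕ` and `V_{n+1} = V_n ∪ 𝒫(V_n)`.  As the stages are
increasing, `V_{n+1} = ℕ ∪ 𝒫(V_n)`, and this union is disjoint. -/
def Stage : ℕ → Type
  | 0 => ℕ
  | n + 1 => ℕ ⊕ Set (Stage n)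

/-- The inclusion `V_n ⊆ V_{n+1}`. -/
def Stage.up : (n : ℕ) → Stage n → Stage (n + 1)
  | 0, k => Sum.inl k
  | _ + 1, Sum.inl k => Sum.inl k
  | n + 1, Sum.inr S => Sum.inr (Stage.up n '' S)

/-- The standard universe `V = ⋃ n, V_n`: elements of the stages, identified along the
inclusions `V_n ⊆ V_{n+1}`. -/
def Superstructure : Type :=
  Quot (fun a b : (Σ n, Stage n) => b = ⟨a.1 + 1, Stage.up a.1 a.2⟩)

namespace Superstructure

/-- An element of `V_n`, as an element of `V`. -/
def of (n : ℕ) (x : Stage n) : Superstructure := Quot.mk _ ⟨n, x⟩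

/-- The natural number `k`, as an urelement of `V`. -/
def nat (k : ℕ) : Superstructure := of 0 k

/-- A subset of `V_n`, as an element of `V`. -/
def ofSet (n : ℕ) (S : Set (Stage n)) : Superstructure := of (n + 1) (Sum.inr S)

/-- The relation `x ∈ y` of `V`. -/
def Mem (x y : Superstructure) : Prop :=
  ∃ (n : ℕ) (a : Stage n) (S : Set (Stage n)), x = of n a ∧ y = ofSet n S ∧ a ∈ S

instance : setLang.Structure Superstructure where
  funMap f := f.elim
  RelMap | .mem => fun v => Mem (v 0) (v 1)

/-- The set `V_n`, as an element of `V`. -/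
def stage (n : ℕ) : Superstructure := ofSet n Set.univ

/-- The set `S ∩ V_n`, as an element of `V`. -/
def sep (n : ℕ) (S : Set Superstructure) : Superstructure := ofSet n {a | of n a ∈ S}

/-- The set of all ordered pairs in `V_3` whose coordinates are related by `R`, as an element of
`V`.  (If the coordinates are in `V_1`, then the ordered pair is in `V_3`.) -/
def graph (R : Superstructure → Superstructure → Prop) : Superstructure :=
  sep 3 {p | ∃ x y, R x y ∧ IsPair p x y}

/-- A relation between natural numbers, as a relation on `V`. -/
def natRel (r : ℕ → ℕ → Prop) (x y : Superstructure) : Prop :=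
  ∃ a b : ℕ, x = nat a ∧ y = nat b ∧ r a b

/-- `x` is a finite set of natural numbers and `y` is the number of its elements. -/
def cardRel (x y : Superstructure) : Prop :=
  ∃ s : Finset ℕ, x = ofSet 0 {k : ℕ | k ∈ s} ∧ y = nat s.card

end Superstructure

/-! ### Nonstandard universes -/

/-- An elementary extension of the standard universe in which there is a nonstandard natural
number.  The nonstandard universe itself is its truncation `starV`. -/
structure NonstandardUniverse where
  /-- The elementary extension before truncation. -/
  Ext : Type u
  [str : setLang.Structure Ext]
  /-- The elementary embedding `x ↦ *x`. -/
  star : Superstructure ↪ₑ[setLang] Ext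
  exists_nonstandard : ∃ x : Ext, Elem x (star (Superstructure.stage 0)) ∧
    ∀ k : ℕ, x ≠ star (Superstructure.nat k)

attribute [instance] NonstandardUniverse.str

namespace NonstandardUniverse

variable (U : NonstandardUniverse.{u})

/-- The truncation at `*∈`-rank `ω`: the set underlying the nonstandard universe `*V`. -/
def starV : Set U.Ext := {x | ∃ n : ℕ, Elem x (U.star (Superstructure.stage n))}

/-- The set `*ℕ`. -/
def starNat : Set U.Ext := {x | Elem x (U.star (Superstructure.stage 0))}

/-- `H` is a hyperfinite integer, that is, `H ∈ *ℕ ∖ ℕ`. -/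
def IsHyperfiniteInteger (H : U.Ext) : Prop :=
  H ∈ U.starNat ∧ ∀ k : ℕ, H ≠ U.star (Superstructure.nat k)

/-- `*V` is `κ`-saturated: a family of fewer than `κ` internal sets with the finite intersection
property has a common element.  (Urelements have no elements, and so do not belong to such a
family.) -/
def IsSaturated (κ : Cardinal.{u}) : Prop :=
  ∀ F : Set U.Ext, F ⊆ U.starV → #F < κ →
    (∀ G : Finset U.Ext, (G : Set U.Ext) ⊆ F → ∃ x ∈ U.starV, ∀ A ∈ G, Elem x A) →
    ∃ x ∈ U.starV, ∀ A ∈ F, Elem x A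

/-- The relation `*R` on `*V`, for a relation `R` on `V` between elements of `V_1`. -/
def starRel (R : Superstructure → Superstructure → Prop) (x y : U.Ext) : Prop :=
  ∃ p : U.Ext, IsPair p x y ∧ Elem p (U.star (Superstructure.graph R))

/-- The nonstandard version of a relation between natural numbers. -/
def starNatRel (r : ℕ → ℕ → Prop) (x y : U.Ext) : Prop :=
  U.starRel (Superstructure.natRel r) x y

/-- `*|A| = N`, for hyperfinite internal sets `A` of elements of `*ℕ`. -/
def StarCard (A N : U.Ext) : Prop := U.starRel Superstructure.cardRel A N

/-- The set `Ω = {1, 2, …, H}`. -/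
def Omega (H : U.Ext) : Type u :=
  {x : U.Ext // Elem x (U.star (Superstructure.stage 0)) ∧
    U.starNatRel (· ≤ ·) (U.star (Superstructure.nat 1)) x ∧ U.starNatRel (· ≤ ·) x H}

/-- The set `*𝒫(Ω)` of all internal subsets of `Ω`: the elements of `*V` that are sets (not
urelements) and all of whose elements are in `Ω`. -/
def internalPowerset (H : U.Ext) : Set U.Ext :=
  {A | A ∈ U.starV ∧ A ∉ U.starNat ∧ ∀ x, Elem x A → ∃ ω : U.Omega H, ω.1 = x}

/-- An internal subset of `Ω`, as a set of elements of `Ω`. -/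
def toSet {H : U.Ext} (A : U.Ext) : Set (U.Omega H) := {ω | Elem ω.1 A}

/-- The standard part of `P(A) = *|A| / H`: the real number which is the supremum of all standard
rational numbers `p / q` such that `p / q ≤ *|A| / H`, that is, `p * H ≤ q * *|A|`. -/
noncomputable def stProb (H A : U.Ext) : ℝ :=
  sSup {r : ℝ | ∃ p q : ℕ, 0 < q ∧ r = (p : ℝ) / (q : ℝ) ∧
    ∃ N, U.StarCard A N ∧ U.starNatRel (fun h a => p * h ≤ q * a) H N}

/-- The outer measure on `Ω` generated by `st ∘ P`: the infimum of `∑ n, st (P (A n))` over all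
countable covers of a set by internal sets `A n`. -/
noncomputable def loebOuterMeasure (H : U.Ext) : OuterMeasure (U.Omega H) :=
  OuterMeasure.boundedBy fun S =>
    ⨅ A ∈ U.internalPowerset H, ⨅ _ : U.toSet A = S, ENNReal.ofReal (U.stProb H A)

/-- The `σ`-algebra of Loeb measurable sets: the Carathéodory measurable sets, which are the
completion of the `σ`-algebra generated by the internal sets. -/
noncomputable instance loebMeasurableSpace (H : U.Ext) : MeasurableSpace (U.Omega H) :=
  (U.loebOuterMeasure H).caratheodory

/-- The Loeb measure `L_P` on the Loeb measurable subsets of `Ω = {1, 2, …, H}`. -/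
noncomputable def loebMeasure (H : U.Ext) : Measure (U.Omega H) :=
  (U.loebOuterMeasure H).toMeasure le_rfl

end NonstandardUniverse

/-! ### Compact probability spaces -/

/-- A family of sets has the finite intersection property. -/
def HasFIP {X : Type*} (D : Set (Set X)) : Prop :=
  ∀ G : Set (Set X), G ⊆ D → G.Finite → (⋂₀ G).Nonempty

/-- A family of sets is compact if every subfamily with the finite intersection property has
nonempty intersection. -/
def IsCompactFamily {X : Type*} (C : Set (Set X)) : Prop :=
  ∀ D : Set (Set X), D ⊆ C → HasFIP D → (⋂₀ D).Nonempty

/-- A probability space is compact if there is a compact family of measurable sets which is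
inner-regular on it. -/
def IsCompactProbabilitySpace {X : Type*} [MeasurableSpace X] (P : Measure X) : Prop :=
  IsProbabilityMeasure P ∧ ∃ C : Set (Set X), (∀ K ∈ C, MeasurableSet K) ∧ IsCompactFamily C ∧
    ∀ A : Set X, MeasurableSet A → P A = ⨆ K ∈ {K | K ∈ C ∧ K ⊆ A}, P K

/-! ### Trees and witnesses -/

/-- A tree without maximal nodes: a set of finite sequences of zeros and ones which is closed
under initial segments and in which every node has a proper extension. -/
structure IsTree (T : Set (List Bool)) : Prop where
  mem_of_prefix : ∀ s s' : List Bool, s <+: s' → s' ∈ T → s ∈ T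
  exists_extension : ∀ s ∈ T, ∃ s' ∈ T, s <+: s' ∧ s ≠ s'

/-- The set `[T]` of all branches of a tree. -/
def branches (T : Set (List Bool)) : Set (ℕ → Bool) :=
  {f | ∀ n : ℕ, List.ofFn (fun i : Fin n => f i) ∈ T}

/-- The fair coin tossing measure on the set of infinite sequences of zeros and ones. -/
noncomputable def coinMeasure : Measure (ℕ → Bool) :=
  Measure.infinitePi fun _ => ProbabilityTheory.uniformOn (Set.univ : Set Bool)

/-- `⟨T α n : α < lam, n < ω⟩` is a `(κ, lam)`-witness. -/
structure IsWitness (κ lam : Cardinal.{u}) (T : lam.ord.ToType → ℕ → Set (List Bool)) : Prop where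
  isTree : ∀ α n, IsTree (T α n)
  measure_gt : ∀ α (n : ℕ), (n : ℝ) / (n + 1) < coinMeasure.real (branches (T α n))
  card_lt : ∀ f : ℕ → Bool, #{α | ∃ n, f ∈ branches (T α n)} < κ

/-! Every internal subset of Ω gets its own sequence of trees: enumerate the internal subsets as
A_α, α < λ. The standard binary digits of a point of Ω define a map `digits` from Ω to the Cantor
space. Prescribing the first n digits fixes the residue modulo 2^n, and as H is infinite each
residue class has internal probability infinitely close to 2^(-n). So `digits` carries the Loeb
measure to the coin tossing measure (`map_digits`), and A_α ∩ digits⁻¹[T_{α,n}] fills A_α up to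
measure 1/(n+1). The compact family consists of all countable intersections of such sets.

Compactness (`isCompactFamily_treeFamily`): extend a subfamily with the finite intersection property
to an ultrafilter. Along it the digits converge to some f, and f lies in each [T_{α,n}] that occurs,
because these sets are closed. By the witness property fewer than κ indices α occur. Hence
κ-saturation gives one point that lies in all the A_α concerned and in the countably many internal
sets which force its digits to be f; this point lies in the whole subfamily.

Inner regularity (`exists_mem_treeFamily`): cover the complement of E by internal sets D_j of nearly
optimal total measure. The sets Ω ∖ D_j are internal, hence of the form A_α; cutting each with a
tree of sufficiently large measure loses little in total.

The rest is foundation. Elementarity is applied through `Transfers`, which pairs a statement about V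
with its counterpart in the extension. Counting inequalities are transferred in the form p·h ≤
q·|A|, which yields finite additivity of the standard part; saturation beyond ℵ₀ makes the Loeb
outer measure agree with it on internal sets. -/

namespace Superstructure

/-! ### The stages of the superstructure -/

/-- A retraction of the superstructure onto its `m`-th stage, restricted to the `n`-th stage. -/
def proj : (n m : ℕ) → Stage n → Stage m
  | 0, 0, k => k
  | 0, _ + 1, k => Sum.inl k
  | _ + 1, 0, Sum.inl k => k
  -- A junk value: all that matters is compatibility with `Stage.up` and being the identity from a
  -- stage to itself.
  | _ + 1, 0, Sum.inr _ => (0 : ℕ)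
  | _ + 1, _ + 1, Sum.inl k => Sum.inl k
  | n + 1, m + 1, Sum.inr S => Sum.inr (proj n m '' S)

theorem proj_self : ∀ (n : ℕ) (x : Stage n), proj n n x = x
  | 0, _ => rfl
  | _ + 1, Sum.inl _ => rfl
  | n + 1, Sum.inr S => by
    have h : proj n n = id := funext (proj_self n)
    change Sum.inr (proj n n '' S) = Sum.inr S
    rw [h, Set.image_id]

theorem proj_up : ∀ (n m : ℕ) (x : Stage n), proj (n + 1) m (Stage.up n x) = proj n m x
  | 0, 0, _ => rfl
  | 0, _ + 1, _ => rfl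
  | _ + 1, 0, Sum.inl _ => rfl
  | _ + 1, 0, Sum.inr _ => rfl
  | _ + 1, _ + 1, Sum.inl _ => rfl
  | n + 1, m + 1, Sum.inr S => by
    have h : (fun x => proj (n + 1) m (Stage.up n x)) = proj n m := funext (proj_up n m)
    simp only [Stage.up, proj]
    rw [Set.image_image, h]

/-- A retraction of the superstructure onto its `m`-th stage. -/
def toStage (m : ℕ) : Superstructure → Stage m :=
  Quot.lift (fun a => proj a.1 m a.2) (by
    rintro ⟨n, x⟩ _ rfl
    exact (proj_up n m x).symm)

theorem toStage_of (n : ℕ) (x : Stage n) : toStage n (of n x) = x := proj_self n x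

/-- A retraction that factors through the quotient separates the points of each stage, so the
generated equivalence relation need not be described. -/
theorem of_injective (n : ℕ) : Function.Injective (of n) :=
  Function.LeftInverse.injective (g := toStage n) (toStage_of n)

theorem of_up (n : ℕ) (x : Stage n) : of (n + 1) (Stage.up n x) = of n x :=
  (Quot.sound (r := fun a b : (Σ n, Stage n) => b = ⟨a.1 + 1, Stage.up a.1 a.2⟩)
    (a := ⟨n, x⟩) (b := ⟨n + 1, Stage.up n x⟩) rfl).symm

theorem exists_of (x : Superstructure) : ∃ n a, x = of n a := by
  induction x using Quot.ind with
  | mk a => exact ⟨a.1, a.2, rfl⟩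

theorem exists_of_add (n k : ℕ) (a : Stage n) : ∃ b, of n a = of (n + k) b := by
  induction k with
  | zero => exact ⟨a, rfl⟩
  | succ k ih =>
    obtain ⟨b, hb⟩ := ih
    exact ⟨Stage.up _ b, by rw [hb, ← of_up]; rfl⟩

theorem of_inl (n k : ℕ) : of (n + 1) (Sum.inl k) = nat k := by
  induction n with
  | zero => exact of_up 0 k
  | succ n ih => rw [← ih]; exact of_up (n + 1) (Sum.inl k)

/-- The set of the elements of an element of the superstructure. -/
def elems : Superstructure → Set Superstructure :=
  Quot.lift (fun a => match a with
    | ⟨0, _⟩ => ∅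
    | ⟨_ + 1, Sum.inl _⟩ => ∅
    | ⟨n + 1, Sum.inr S⟩ => of n '' S) (by
    rintro ⟨_ | n, x⟩ _ rfl
    · rfl
    · rcases x with k | S
      · rfl
      · change of n '' S = of (n + 1) '' (Stage.up n '' S)
        rw [Set.image_image]
        simp only [of_up])

theorem elems_ofSet (n : ℕ) (S : Set (Stage n)) : elems (ofSet n S) = of n '' S := rfl

theorem exists_nat_or_ofSet (x : Superstructure) :
    (∃ k, x = nat k) ∨ ∃ n S, x = ofSet n S := by
  obtain ⟨n, a, rfl⟩ := exists_of x
  rcases n with _ | n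
  · exact Or.inl ⟨a, rfl⟩
  · rcases a with k | S
    · exact Or.inl ⟨k, of_inl n k⟩
    · exact Or.inr ⟨n, S, rfl⟩

theorem elem_iff (x y : Superstructure) : Elem x y ↔ x ∈ elems y := by
  change Mem x y ↔ _
  constructor
  · rintro ⟨n, a, S, rfl, rfl, h⟩
    exact ⟨a, h, rfl⟩
  · intro h
    obtain ⟨k, rfl⟩ | ⟨n, S, rfl⟩ := exists_nat_or_ofSet y
    · exact h.elim
    · obtain ⟨a, ha, rfl⟩ := h
      exact ⟨n, a, S, rfl, rfl, ha⟩

/-- Inclusions of stages act on sets by taking images. This moves sets built at different stages to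
a common one, where extensionality is equality of `Set`s. -/
theorem ofSet_add (n k : ℕ) (S : Set (Stage n)) :
    ofSet n S = ofSet (n + k) (of (n + k) ⁻¹' (of n '' S)) := by
  induction k with
  | zero => rw [Nat.add_zero, Set.preimage_image_eq _ (of_injective n)]
  | succ k ih =>
    rw [ih]
    set S' := of (n + k) ⁻¹' (of n '' S) with hS'
    have h : of n '' S = of (n + k) '' S' := by
      rw [hS', Set.image_preimage_eq_of_subset]
      rintro _ ⟨a, -, rfl⟩
      obtain ⟨b, hb⟩ := exists_of_add n k a
      exact ⟨b, hb.symm⟩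
    have h' : of (n + k) '' S' = of (n + (k + 1)) '' (Stage.up (n + k) '' S') := by
      rw [Set.image_image]
      exact Set.image_congr fun a _ => (of_up (n + k) a).symm
    rw [h, h', Set.preimage_image_eq _ (of_injective _)]
    exact (of_up (n + k + 1) (Sum.inr S')).symm

theorem ofSet_ext {n m : ℕ} {S : Set (Stage n)} {T : Set (Stage m)}
    (h : of n '' S = of m '' T) : ofSet n S = ofSet m T := by
  rw [ofSet_add n m S, ofSet_add m n T, h, Nat.add_comm]

theorem elem_ofSet {n : ℕ} {S : Set (Stage n)} {x : Superstructure} :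
    Elem x (ofSet n S) ↔ ∃ a ∈ S, x = of n a := by
  rw [elem_iff, elems_ofSet]
  simp only [Set.mem_image, eq_comm]

theorem nat_injective : Function.Injective nat := of_injective 0

theorem elem_stage_zero {x : Superstructure} : Elem x (stage 0) ↔ ∃ k, x = nat k := by
  rw [stage, elem_ofSet]
  exact ⟨fun ⟨k, _, h⟩ => ⟨k, h⟩, fun ⟨k, h⟩ => ⟨k, trivial, h⟩⟩

theorem elem_stage {n : ℕ} {x : Superstructure} : Elem x (stage n) ↔ ∃ a, x = of n a := by
  rw [stage, elem_ofSet]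
  simp

/-- A set of natural numbers, as an element of the superstructure. -/
def natSet (S : Set ℕ) : Superstructure := ofSet 0 S

/-- The power set of `ℕ`, as an element of the superstructure. -/
def natPowerset : Superstructure := ofSet 1 (Set.range Sum.inr)

theorem elem_natPowerset {x : Superstructure} : Elem x natPowerset ↔ ∃ S, x = natSet S := by
  rw [natPowerset, elem_ofSet]
  exact ⟨by rintro ⟨_, ⟨S, rfl⟩, h⟩; exact ⟨S, h⟩, fun ⟨S, h⟩ => ⟨_, ⟨S, rfl⟩, h⟩⟩

theorem elem_natSet {S : Set ℕ} {x : Superstructure} :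
    Elem x (natSet S) ↔ ∃ k ∈ S, x = nat k := elem_ofSet

theorem nat_elem_natSet {S : Set ℕ} {k : ℕ} : Elem (nat k) (natSet S) ↔ k ∈ S := by
  rw [elem_natSet]
  exact ⟨fun ⟨_, h, e⟩ => nat_injective e ▸ h, fun h => ⟨k, h, rfl⟩⟩

theorem natSet_injective : Function.Injective natSet := fun S T h => by
  ext k
  rw [← nat_elem_natSet, h, nat_elem_natSet]

theorem natSet_ne_nat (S : Set ℕ) (k : ℕ) : natSet S ≠ nat k := fun h => by
  have h' : of 1 (Sum.inr S) = of 1 (Sum.inl k) := h.trans (of_inl 0 k).symm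
  exact Sum.inr_ne_inl (of_injective 1 h')

/-- A set of urelements already appears in V_1. The transferred form places every internal subset of
Ω in the star of the power set of ℕ, where all later transfers take place. -/
theorem elem_natPowerset_of_elem_stage {n : ℕ} {x : Superstructure} (_ : Elem x (stage n))
    (hx : ¬ Elem x (stage 0)) (h : ∀ y, Elem y x → Elem y (stage 0)) : Elem x natPowerset := by
  obtain ⟨k, rfl⟩ | ⟨m, S, rfl⟩ := exists_nat_or_ofSet x
  · exact (hx (elem_stage_zero.2 ⟨k, rfl⟩)).elim
  · refine elem_natPowerset.2 ⟨{k | Elem (nat k) (ofSet m S)}, ofSet_ext (Set.ext fun y => ?_)⟩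
    constructor
    · rintro ⟨a, ha, rfl⟩
      have ha' := elem_ofSet.2 ⟨a, ha, rfl⟩
      obtain ⟨k, hk⟩ := elem_stage_zero.1 (h _ ha')
      exact ⟨k, by rw [hk] at ha'; exact ha', hk.symm⟩
    · rintro ⟨k, hk, rfl⟩
      obtain ⟨a, ha, e⟩ := elem_ofSet.1 hk
      exact ⟨a, ha, e.symm⟩

/-! ### Pairs and graphs -/

/-- The usual argument for Kuratowski pairs; it only compares members, so no extensionality of the
structure is required. -/
theorem _root_.IsPair.eq {M : Type*} [setLang.Structure M] {p x y x' y' : M}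
    (h : IsPair p x y) (h' : IsPair p x' y') : x = x' ∧ y = y' := by
  obtain ⟨a, b, ha, hb, hp⟩ := h
  obtain ⟨a', b', ha', hb', hp'⟩ := h'
  have h1 : a' = a ∨ a' = b := (hp a').1 ((hp' a').2 (Or.inl rfl))
  have h2 : b' = a ∨ b' = b := (hp b').1 ((hp' b').2 (Or.inr rfl))
  have h3 : a = a' ∨ a = b' := (hp' a).1 ((hp a).2 (Or.inl rfl))
  have h4 : b = a' ∨ b = b' := (hp' b).1 ((hp b).2 (Or.inr rfl))
  have hx : x = x' := by
    rcases h3 with rfl | rfl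
    · exact (ha' x).1 ((ha x).2 rfl)
    · exact ((ha x').1 ((hb' x').2 (Or.inl rfl))).symm
  subst hx
  refine ⟨rfl, ?_⟩
  have hy : y = x ∨ y = y' := by
    rcases h4 with rfl | rfl
    · exact Or.inl ((ha' y).1 ((hb y).2 (Or.inr rfl)))
    · exact (hb' y).1 ((hb y).2 (Or.inr rfl))
  have hy' : y' = x ∨ y' = y := by
    rcases h2 with rfl | rfl
    · exact Or.inl ((ha y').1 ((hb' y').2 (Or.inr rfl)))
    · exact (hb y').1 ((hb' y').2 (Or.inr rfl))
  rcases hy with rfl | rfl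
  · rcases hy' with rfl | rfl <;> rfl
  · rfl

theorem exists_isPair (a b : Stage 1) : ∃ p : Stage 3, IsPair (of 3 p) (of 1 a) (of 1 b) := by
  refine ⟨Sum.inr {Sum.inr {a}, Sum.inr {a, b}}, of 2 (Sum.inr {a}), of 2 (Sum.inr {a, b}),
    fun z => ?_, fun z => ?_, fun z => ?_⟩
  · exact elem_ofSet.trans (by simp)
  · exact elem_ofSet.trans (by simp)
  · refine elem_ofSet.trans ⟨?_, ?_⟩
    · rintro ⟨_, rfl | rfl, h⟩
      exacts [Or.inl h, Or.inr h]
    · rintro (h | h)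
      exacts [⟨_, Or.inl rfl, h⟩, ⟨_, Or.inr rfl, h⟩]

theorem exists_isPair_elem_graph_iff {R : Superstructure → Superstructure → Prop}
    (hR : ∀ x y, R x y → (∃ a, x = of 1 a) ∧ ∃ b, y = of 1 b) (x y : Superstructure) :
    (∃ p, IsPair p x y ∧ Elem p (graph R)) ↔ R x y := by
  constructor
  · rintro ⟨p, hp, h⟩
    obtain ⟨a, ⟨x', y', hR', hp'⟩, rfl⟩ := elem_ofSet.1 h
    obtain ⟨rfl, rfl⟩ := hp.eq hp'
    exact hR'
  · intro h
    obtain ⟨⟨a, rfl⟩, b, rfl⟩ := hR x y h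
    obtain ⟨p, hp⟩ := exists_isPair a b
    exact ⟨_, hp, elem_ofSet.2 ⟨p, ⟨_, _, h, hp⟩, rfl⟩⟩

theorem natRel_nat {r : ℕ → ℕ → Prop} {a b : ℕ} : natRel r (nat a) (nat b) ↔ r a b := by
  constructor
  · rintro ⟨a', b', ha, hb, h⟩
    rwa [nat_injective ha, nat_injective hb]
  · exact fun h => ⟨a, b, rfl, rfl, h⟩

theorem cardRel_natSet {S : Set ℕ} {y : Superstructure} :
    cardRel (natSet S) y ↔ S.Finite ∧ y = nat S.ncard := by
  constructor
  · rintro ⟨s, h, rfl⟩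
    obtain rfl : S = s := natSet_injective h
    exact ⟨s.finite_toSet, by rw [Set.ncard_coe_finset]⟩
  · rintro ⟨hS, rfl⟩
    lift S to Finset ℕ using hS
    exact ⟨S, rfl, by rw [Set.ncard_coe_finset]⟩

end Superstructure

/-! ### Transfer -/

namespace NonstandardUniverse

variable {U : NonstandardUniverse.{u}} {α : Type}

variable (U) in
/-- `P` and `P'` are defined by the same formula, with parameters in the standard universe. -/
def Transfers (P : (α → Superstructure) → Prop) (P' : (α → U.Ext) → Prop) : Prop :=
  ∃ φ : setLang.Formula (α ⊕ Superstructure),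
    (∀ v, φ.Realize (Sum.elim v id) ↔ P v) ∧ ∀ v, φ.Realize (Sum.elim v U.star) ↔ P' v

variable (U) in
/-- `t` and `t'` are given by the same variable or by the same standard parameter. -/
def TransfersTerm (t : (α → Superstructure) → Superstructure) (t' : (α → U.Ext) → U.Ext) : Prop :=
  ∃ i : α ⊕ Superstructure, (∀ v, Sum.elim v id i = t v) ∧ ∀ v, Sum.elim v U.star i = t' v

/-- Elementarity of `U.star` for a sentence with standard parameters. When it is applied to a goal
about the extension, the standard statement `P` stays open and is found by unification as the
closure lemmas below take the goal apart. -/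
theorem Transfers.mp {P : (Empty → Superstructure) → Prop} {P' : Prop}
    (h : Transfers U P (fun _ => P')) (hP : ∀ v, P v) : P' := by
  obtain ⟨φ, h1, h2⟩ := h
  refine (h2 Empty.elim).1 ?_
  have hP' := (U.star.map_formula φ (Sum.elim Empty.elim id)).2 ((h1 Empty.elim).2 (hP _))
  convert hP' using 1
  ext (i | i)
  · exact i.elim
  · rfl

theorem TransfersTerm.var (i : α) : TransfersTerm U (fun v => v i) (fun v => v i) :=
  ⟨Sum.inl i, fun _ => rfl, fun _ => rfl⟩

theorem TransfersTerm.const (c : Superstructure) :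
    TransfersTerm (α := α) U (fun _ => c) (fun _ => U.star c) :=
  ⟨Sum.inr c, fun _ => rfl, fun _ => rfl⟩

/-- Separates the variable `none` from the other variables and the parameters. -/
def bindLast {β : Type} : Option α ⊕ β → (α ⊕ β) ⊕ Unit
  | Sum.inl none => Sum.inr ()
  | Sum.inl (some a) => Sum.inl (Sum.inl a)
  | Sum.inr c => Sum.inl (Sum.inr c)

theorem realize_iAlls_bindLast {M : Type*} [setLang.Structure M]
    (φ : setLang.Formula (Option α ⊕ Superstructure)) (c : Superstructure → M) (v : α → M) :
    ((φ.relabel bindLast).iAlls Unit).Realize (Sum.elim v c) ↔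
      ∀ x, φ.Realize (Sum.elim (fun o : Option α => o.elim x v) c) := by
  have key : ∀ i : Unit → M, (fun a => Sum.elim (Sum.elim v c) i a) ∘ bindLast =
      Sum.elim (fun o : Option α => o.elim (i ()) v) c := by
    intro i
    ext ((_ | a) | c) <;> rfl
  rw [FirstOrder.Language.Formula.realize_iAlls]
  simp only [FirstOrder.Language.Formula.realize_relabel, key]
  exact ⟨fun h x => h (fun _ => x), fun h i => h (i ())⟩

/-- The membership symbol. -/
def memSymbol : setLang.Relations 2 := MemSymbol.mem

theorem realize_memSymbol {β M : Type*} [setLang.Structure M] (i j : β) (v : β → M) :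
    (memSymbol.formula ![FirstOrder.Language.Term.var i, FirstOrder.Language.Term.var j]).Realize v
      ↔ Elem (v i) (v j) := by
  rw [FirstOrder.Language.Formula.realize_rel, Elem]
  refine iff_of_eq (congrArg (FirstOrder.Language.Structure.RelMap memSymbol) ?_)
  ext x
  fin_cases x <;> rfl

/-! ### Closure of transferable statements under logical operations -/

namespace Transfers

variable {P Q : (α → Superstructure) → Prop} {P' Q' : (α → U.Ext) → Prop}
  {s t r : (α → Superstructure) → Superstructure} {s' t' r' : (α → U.Ext) → U.Ext}

theorem imp (h : Transfers U P P') (k : Transfers U Q Q') :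
    Transfers U (fun v => P v → Q v) (fun v => P' v → Q' v) := by
  obtain ⟨φ, h1, h2⟩ := h
  obtain ⟨ψ, k1, k2⟩ := k
  exact ⟨φ.imp ψ, by simp [h1, k1], by simp [h2, k2]⟩

theorem falsum : Transfers (α := α) U (fun _ => False) (fun _ => False) :=
  ⟨⊥, by simp, by simp⟩

theorem not (h : Transfers U P P') : Transfers U (fun v => ¬ P v) (fun v => ¬ P' v) :=
  h.imp falsum

theorem and (h : Transfers U P P') (k : Transfers U Q Q') :
    Transfers U (fun v => P v ∧ Q v) (fun v => P' v ∧ Q' v) := by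
  obtain ⟨φ, h1, h2⟩ := h
  obtain ⟨ψ, k1, k2⟩ := k
  exact ⟨φ ⊓ ψ, by simp [h1, k1], by simp [h2, k2]⟩

theorem or (h : Transfers U P P') (k : Transfers U Q Q') :
    Transfers U (fun v => P v ∨ Q v) (fun v => P' v ∨ Q' v) := by
  obtain ⟨φ, h1, h2⟩ := h
  obtain ⟨ψ, k1, k2⟩ := k
  exact ⟨φ ⊔ ψ, by simp [h1, k1], by simp [h2, k2]⟩

theorem iff (h : Transfers U P P') (k : Transfers U Q Q') :
    Transfers U (fun v => P v ↔ Q v) (fun v => P' v ↔ Q' v) := by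
  obtain ⟨φ, h1, h2⟩ := h
  obtain ⟨ψ, k1, k2⟩ := k
  exact ⟨φ.iff ψ, by simp [h1, k1], by simp [h2, k2]⟩

theorem all {P : (α → Superstructure) → Superstructure → Prop} {P' : (α → U.Ext) → U.Ext → Prop}
    (h : Transfers U (fun v : Option α → _ => P (fun i => v (some i)) (v none))
      (fun v => P' (fun i => v (some i)) (v none))) :
    Transfers U (fun v => ∀ x, P v x) (fun v => ∀ x, P' v x) := by
  obtain ⟨φ, h1, h2⟩ := h
  exact ⟨(φ.relabel bindLast).iAlls Unit,
    fun v => (realize_iAlls_bindLast φ id v).trans (forall_congr' fun x => h1 _),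
    fun v => (realize_iAlls_bindLast φ U.star v).trans (forall_congr' fun x => h2 _)⟩

theorem congr (h : Transfers U P P') (hQ : ∀ v, Q v ↔ P v) (hQ' : ∀ v, Q' v ↔ P' v) :
    Transfers U Q Q' := by
  obtain ⟨φ, h1, h2⟩ := h
  exact ⟨φ, fun v => (h1 v).trans (hQ v).symm, fun v => (h2 v).trans (hQ' v).symm⟩

theorem ex {P : (α → Superstructure) → Superstructure → Prop} {P' : (α → U.Ext) → U.Ext → Prop}
    (h : Transfers U (fun v : Option α → _ => P (fun i => v (some i)) (v none))
      (fun v => P' (fun i => v (some i)) (v none))) :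
    Transfers U (fun v => ∃ x, P v x) (fun v => ∃ x, P' v x) :=
  (all (P := fun v x => ¬ P v x) (P' := fun v x => ¬ P' v x) h.not).not.congr
    (fun v => by simp) (fun v => by simp)

/-- A variant of `Transfers.all` from which the standard side can be computed. -/
theorem forall_extend {Q : (Option α → Superstructure) → Prop}
    {P' : (α → U.Ext) → U.Ext → Prop}
    (h : Transfers U Q (fun v => P' (fun i => v (some i)) (v none))) :
    Transfers U (fun v => ∀ x, Q (fun o => o.elim x v)) (fun v => ∀ x, P' v x) :=
  all (P := fun v x => Q (fun o => o.elim x v)) <|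
    h.congr (fun v => iff_of_eq (congrArg Q (by ext (_ | i) <;> rfl))) (fun _ => Iff.rfl)

/-- A variant of `Transfers.ex` from which the standard side can be computed. -/
theorem exists_extend {Q : (Option α → Superstructure) → Prop}
    {P' : (α → U.Ext) → U.Ext → Prop}
    (h : Transfers U Q (fun v => P' (fun i => v (some i)) (v none))) :
    Transfers U (fun v => ∃ x, Q (fun o => o.elim x v)) (fun v => ∃ x, P' v x) :=
  ex (P := fun v x => Q (fun o => o.elim x v)) <|
    h.congr (fun v => iff_of_eq (congrArg Q (by ext (_ | i) <;> rfl))) (fun _ => Iff.rfl)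

theorem mem (hs : TransfersTerm U s s') (ht : TransfersTerm U t t') :
    Transfers U (fun v => Elem (s v) (t v)) (fun v => Elem (s' v) (t' v)) := by
  obtain ⟨i, h1, h2⟩ := hs
  obtain ⟨j, k1, k2⟩ := ht
  refine ⟨memSymbol.formula ![FirstOrder.Language.Term.var i, FirstOrder.Language.Term.var j],
    fun v => ?_, fun v => ?_⟩
  · rw [realize_memSymbol, h1, k1]
  · rw [realize_memSymbol, h2, k2]

theorem eq (hs : TransfersTerm U s s') (ht : TransfersTerm U t t') :
    Transfers U (fun v => s v = t v) (fun v => s' v = t' v) := by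
  obtain ⟨i, h1, h2⟩ := hs
  obtain ⟨j, k1, k2⟩ := ht
  refine ⟨(FirstOrder.Language.Term.var i).equal (FirstOrder.Language.Term.var j),
    fun v => ?_, fun v => ?_⟩
  · rw [FirstOrder.Language.Formula.realize_equal]
    simp [h1, k1]
  · rw [FirstOrder.Language.Formula.realize_equal]
    simp [h2, k2]

theorem comp {β : Type} (f : α → β ⊕ Superstructure) (h : Transfers U P P') :
    Transfers U (fun v : β → _ => P (fun i => Sum.elim v id (f i)))
      (fun v => P' (fun i => Sum.elim v U.star (f i))) := by
  obtain ⟨φ, h1, h2⟩ := h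
  refine ⟨FirstOrder.Language.Formula.relabel (Sum.elim f Sum.inr) φ, fun v => ?_, fun v => ?_⟩
  · rw [FirstOrder.Language.Formula.realize_relabel]
    refine Iff.trans (iff_of_eq (congrArg φ.Realize ?_)) (h1 _)
    ext (i | i) <;> rfl
  · rw [FirstOrder.Language.Formula.realize_relabel]
    refine Iff.trans (iff_of_eq (congrArg φ.Realize ?_)) (h2 _)
    ext (i | i) <;> rfl

/-- Substitution of terms in a binary relation. -/
theorem subst {R : Superstructure → Superstructure → Prop} {R' : U.Ext → U.Ext → Prop}
    (h : Transfers U (fun v : Bool → _ => R (v true) (v Bool.false))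
      (fun v => R' (v true) (v Bool.false)))
    (hs : TransfersTerm U s s') (ht : TransfersTerm U t t') :
    Transfers U (fun v => R (s v) (t v)) (fun v => R' (s' v) (t' v)) := by
  obtain ⟨i, h1, h2⟩ := hs
  obtain ⟨j, k1, k2⟩ := ht
  have := comp (fun b : Bool => bif b then i else j) h
  simpa only [cond_true, cond_false, h1, h2, k1, k2] using this

/-- In V, a relation between elements of V_1 is the same as membership of the pair in its graph;
`starRel` is that membership formula read in the extension. -/
theorem rel {R : Superstructure → Superstructure → Prop}
    (hR : ∀ x y, R x y → (∃ a, x = Superstructure.of 1 a) ∧ ∃ b, y = Superstructure.of 1 b)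
    (hs : TransfersTerm U s s') (ht : TransfersTerm U t t') :
    Transfers U (fun v => R (s v) (t v)) (fun v => U.starRel R (s' v) (t' v)) := by
  refine subst (R := R) (R' := U.starRel R) ?_ hs ht
  refine congr (P := fun v => ∃ p, IsPair p (v true) (v Bool.false) ∧
      Elem p (Superstructure.graph R))
    (P' := fun v => ∃ p, IsPair p (v true) (v Bool.false) ∧
      Elem p (U.star (Superstructure.graph R)))
    ?_ (fun v => (Superstructure.exists_isPair_elem_graph_iff hR _ _).symm) (fun v => Iff.rfl)
  simp only [IsPair]
  repeat' first
    | exact TransfersTerm.var _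
    | exact TransfersTerm.const _
    | apply ex
    | apply all
    | apply and
    | apply or
    | apply iff
    | apply mem
    | apply eq

theorem natRel (r : ℕ → ℕ → Prop) (hs : TransfersTerm U s s') (ht : TransfersTerm U t t') :
    Transfers U (fun v => Superstructure.natRel r (s v) (t v))
      (fun v => U.starNatRel r (s' v) (t' v)) := by
  refine rel ?_ hs ht
  rintro _ _ ⟨a, b, rfl, rfl, -⟩
  exact ⟨⟨Sum.inl a, (Superstructure.of_inl 0 a).symm⟩, Sum.inl b, (Superstructure.of_inl 0 b).symm⟩

theorem cardRel (hs : TransfersTerm U s s') (ht : TransfersTerm U t t') :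
    Transfers U (fun v => Superstructure.cardRel (s v) (t v))
      (fun v => U.StarCard (s' v) (t' v)) := by
  refine rel ?_ hs ht
  rintro _ _ ⟨s, rfl, rfl⟩
  exact ⟨⟨Sum.inr _, rfl⟩, Sum.inl _, (Superstructure.of_inl 0 _).symm⟩

end Transfers

end NonstandardUniverse

/-! ### Internal sets of natural numbers and their cardinalities -/

namespace Superstructure

/-- `x` is a natural number between `1` and `h`. -/
def InOmega (h x : Superstructure) : Prop :=
  Elem x (stage 0) ∧ natRel (· ≤ ·) (nat 1) x ∧ natRel (· ≤ ·) x h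

/-- `p / q ≤ |A| / h`. -/
def CountGe (p q : ℕ) (h A : Superstructure) : Prop :=
  ∃ N, cardRel A N ∧ natRel (fun h a => p * h ≤ q * a) h N

theorem inOmega_nat {h k : ℕ} : InOmega (nat h) (nat k) ↔ k ∈ Set.Icc 1 h := by
  simp only [InOmega, natRel_nat, elem_stage_zero, Set.mem_Icc]
  exact ⟨fun h => h.2, fun h => ⟨⟨k, rfl⟩, h⟩⟩

theorem countGe_iff {p q h : ℕ} {S : Set ℕ} :
    CountGe p q (nat h) (natSet S) ↔ S.Finite ∧ p * h ≤ q * S.ncard := by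
  constructor
  · rintro ⟨N, hN, hr⟩
    obtain ⟨hS, rfl⟩ := cardRel_natSet.1 hN
    exact ⟨hS, (natRel_nat (r := fun h a => p * h ≤ q * a)).1 hr⟩
  · rintro ⟨hS, h'⟩
    exact ⟨_, cardRel_natSet.2 ⟨hS, rfl⟩, (natRel_nat (r := fun h a => p * h ≤ q * a)).2 h'⟩

theorem subset_Icc_of_forall {h : ℕ} {S : Set ℕ} (hS : ∀ x, Elem x (natSet S) → InOmega (nat h) x) :
    S ⊆ Set.Icc 1 h :=
  fun _ hk => inOmega_nat.1 (hS _ (nat_elem_natSet.2 hk))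

end Superstructure

namespace NonstandardUniverse

open Superstructure

variable {U : NonstandardUniverse.{u}} {α : Type}

variable (U) in
/-- `x` is an element of `*ℕ` between `1` and `h`. -/
def InOmega (h x : U.Ext) : Prop :=
  Elem x (U.star (stage 0)) ∧ U.starNatRel (· ≤ ·) (U.star (nat 1)) x ∧ U.starNatRel (· ≤ ·) x h

variable (U) in
/-- `p / q ≤ *|A| / h`. -/
def CountGe (p q : ℕ) (h A : U.Ext) : Prop :=
  ∃ N, U.StarCard A N ∧ U.starNatRel (fun h a => p * h ≤ q * a) h N

namespace Transfers

variable {s t : (α → Superstructure) → Superstructure} {s' t' : (α → U.Ext) → U.Ext}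

theorem inOmega (hs : TransfersTerm U s s') (ht : TransfersTerm U t t') :
    Transfers U (fun v => Superstructure.InOmega (s v) (t v)) (fun v => U.InOmega (s' v) (t' v)) :=
  ((mem ht (.const _)).and ((natRel _ (.const _) ht).and (natRel _ ht hs)))

theorem countGe (p q : ℕ) (hs : TransfersTerm U s s') (ht : TransfersTerm U t t') :
    Transfers U (fun v => Superstructure.CountGe p q (s v) (t v))
      (fun v => U.CountGe p q (s' v) (t' v)) := by
  refine subst (R := Superstructure.CountGe p q) (R' := U.CountGe p q) ?_ hs ht
  exact ex ((cardRel (.var (some Bool.false)) (.var none)).and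
    (natRel _ (.var (some true)) (.var none)))

end Transfers

/-! ### Transferred Boolean algebra of internal sets -/

theorem elem_natPowerset_of_elem_stage {n : ℕ} : ∀ x : U.Ext, Elem x (U.star (stage n)) →
    ¬ Elem x (U.star (stage 0)) → (∀ y, Elem y x → Elem y (U.star (stage 0))) →
    Elem x (U.star natPowerset) := by
  apply Transfers.mp
  case h =>
    apply_rules [TransfersTerm.var, TransfersTerm.const, Transfers.inOmega, Transfers.countGe,
      Transfers.natRel, Transfers.not, Transfers.imp, Transfers.and, Transfers.or, Transfers.iff,
      Transfers.mem, Transfers.eq, Transfers.exists_extend, Transfers.forall_extend]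
  case hP => exact fun _ x => Superstructure.elem_natPowerset_of_elem_stage

theorem elem_stage_one_of_elem_natPowerset : ∀ x : U.Ext, Elem x (U.star natPowerset) →
    Elem x (U.star (stage 1)) ∧ ¬ Elem x (U.star (stage 0)) := by
  apply Transfers.mp
  case h =>
    apply_rules [TransfersTerm.var, TransfersTerm.const, Transfers.inOmega, Transfers.countGe,
      Transfers.natRel, Transfers.not, Transfers.imp, Transfers.and, Transfers.or, Transfers.iff,
      Transfers.mem, Transfers.eq, Transfers.exists_extend, Transfers.forall_extend]
  case hP =>
    intro _ x hx
    obtain ⟨S, rfl⟩ := elem_natPowerset.1 hx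
    refine ⟨elem_stage.2 ⟨_, rfl⟩, fun h => ?_⟩
    obtain ⟨k, hk⟩ := elem_stage_zero.1 h
    exact natSet_ne_nat S k hk

theorem exists_omega : ∀ h : U.Ext, Elem h (U.star (stage 0)) →
    ∃ A, Elem A (U.star natPowerset) ∧ ∀ x, Elem x A ↔ U.InOmega h x := by
  apply Transfers.mp
  case h =>
    apply_rules [TransfersTerm.var, TransfersTerm.const, Transfers.inOmega, Transfers.countGe,
      Transfers.natRel, Transfers.not, Transfers.imp, Transfers.and, Transfers.or, Transfers.iff,
      Transfers.mem, Transfers.eq, Transfers.exists_extend, Transfers.forall_extend]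
  case hP =>
    intro _ h hh
    obtain ⟨h, rfl⟩ := elem_stage_zero.1 hh
    refine ⟨natSet (Set.Icc 1 h), elem_natPowerset.2 ⟨_, rfl⟩,
      fun x => ⟨fun hx => ?_, fun hx => ?_⟩⟩
    · obtain ⟨k, hk, rfl⟩ := elem_natSet.1 hx
      exact inOmega_nat.2 hk
    · obtain ⟨k, rfl⟩ := elem_stage_zero.1 hx.1
      exact nat_elem_natSet.2 (inOmega_nat.1 hx)

theorem exists_diff : ∀ A B : U.Ext, Elem A (U.star natPowerset) → Elem B (U.star natPowerset) →
    ∃ C, Elem C (U.star natPowerset) ∧ ∀ x, Elem x C ↔ Elem x A ∧ ¬ Elem x B := by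
  apply Transfers.mp
  case h =>
    apply_rules [TransfersTerm.var, TransfersTerm.const, Transfers.inOmega, Transfers.countGe,
      Transfers.natRel, Transfers.not, Transfers.imp, Transfers.and, Transfers.or, Transfers.iff,
      Transfers.mem, Transfers.eq, Transfers.exists_extend, Transfers.forall_extend]
  case hP =>
    intro _ A B hA hB
    obtain ⟨A, rfl⟩ := elem_natPowerset.1 hA
    obtain ⟨B, rfl⟩ := elem_natPowerset.1 hB
    refine ⟨natSet (A \ B), elem_natPowerset.2 ⟨_, rfl⟩,
      fun x => ⟨fun hx => ?_, fun hx => ?_⟩⟩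
    · obtain ⟨k, hk, rfl⟩ := elem_natSet.1 hx
      exact ⟨nat_elem_natSet.2 hk.1, fun h => hk.2 (nat_elem_natSet.1 h)⟩
    · obtain ⟨k, hk, rfl⟩ := elem_natSet.1 hx.1
      exact nat_elem_natSet.2 ⟨hk, fun h => hx.2 (nat_elem_natSet.2 h)⟩

theorem star_natSet_elem (S : Set ℕ) : Elem (U.star (natSet S)) (U.star natPowerset) := by
  apply Transfers.mp
  case h =>
    apply_rules [TransfersTerm.var, TransfersTerm.const, Transfers.inOmega, Transfers.countGe,
      Transfers.natRel, Transfers.not, Transfers.imp, Transfers.and, Transfers.or, Transfers.iff,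
      Transfers.mem, Transfers.eq, Transfers.exists_extend, Transfers.forall_extend]
  case hP => exact fun _ => elem_natPowerset.2 ⟨S, rfl⟩

theorem elem_star_inter (S T : Set ℕ) : ∀ x : U.Ext, Elem x (U.star (natSet (S ∩ T))) ↔
    Elem x (U.star (natSet S)) ∧ Elem x (U.star (natSet T)) := by
  apply Transfers.mp
  case h =>
    apply_rules [TransfersTerm.var, TransfersTerm.const, Transfers.inOmega, Transfers.countGe,
      Transfers.natRel, Transfers.not, Transfers.imp, Transfers.and, Transfers.or, Transfers.iff,
      Transfers.mem, Transfers.eq, Transfers.exists_extend, Transfers.forall_extend]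
  case hP =>
    refine fun _ x => ⟨fun hx => ?_, fun hx => ?_⟩
    · obtain ⟨k, hk, rfl⟩ := elem_natSet.1 hx
      exact ⟨nat_elem_natSet.2 hk.1, nat_elem_natSet.2 hk.2⟩
    · obtain ⟨k, hk, rfl⟩ := elem_natSet.1 hx.1
      exact nat_elem_natSet.2 ⟨hk, nat_elem_natSet.1 hx.2⟩

theorem elem_star_compl (S : Set ℕ) : ∀ x : U.Ext, Elem x (U.star (stage 0)) →
    (Elem x (U.star (natSet Sᶜ)) ↔ ¬ Elem x (U.star (natSet S))) := by
  apply Transfers.mp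
  case h =>
    apply_rules [TransfersTerm.var, TransfersTerm.const, Transfers.inOmega, Transfers.countGe,
      Transfers.natRel, Transfers.not, Transfers.imp, Transfers.and, Transfers.or, Transfers.iff,
      Transfers.mem, Transfers.eq, Transfers.exists_extend, Transfers.forall_extend]
  case hP =>
    intro _ x hx
    obtain ⟨k, rfl⟩ := elem_stage_zero.1 hx
    change Elem (nat k) (natSet Sᶜ) ↔ ¬ Elem (nat k) (natSet S)
    rw [nat_elem_natSet, nat_elem_natSet, Set.mem_compl_iff]

theorem elem_star_univ : ∀ x : U.Ext, Elem x (U.star (stage 0)) →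
    Elem x (U.star (natSet Set.univ)) := by
  apply Transfers.mp
  case h =>
    apply_rules [TransfersTerm.var, TransfersTerm.const, Transfers.inOmega, Transfers.countGe,
      Transfers.natRel, Transfers.not, Transfers.imp, Transfers.and, Transfers.or, Transfers.iff,
      Transfers.mem, Transfers.eq, Transfers.exists_extend, Transfers.forall_extend]
  case hP =>
    intro _ x hx
    obtain ⟨k, rfl⟩ := elem_stage_zero.1 hx
    exact nat_elem_natSet.2 trivial

/-! ### Infinite numbers exceed all standard ones -/

theorem natRel_zero_lt : ∀ h : U.Ext, Elem h (U.star (stage 0)) → h ≠ U.star (nat 0) →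
    U.starNatRel (· < ·) (U.star (nat 0)) h := by
  apply Transfers.mp
  case h =>
    apply_rules [TransfersTerm.var, TransfersTerm.const, Transfers.inOmega, Transfers.countGe,
      Transfers.natRel, Transfers.not, Transfers.imp, Transfers.and, Transfers.or, Transfers.iff,
      Transfers.mem, Transfers.eq, Transfers.exists_extend, Transfers.forall_extend]
  case hP =>
    intro _ h hh hne
    obtain ⟨h, rfl⟩ := elem_stage_zero.1 hh
    exact natRel_nat.2 (Nat.pos_of_ne_zero fun e => hne (congrArg nat e))

theorem natRel_succ_lt (k : ℕ) : ∀ h : U.Ext, Elem h (U.star (stage 0)) →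
    h ≠ U.star (nat (k + 1)) → U.starNatRel (· < ·) (U.star (nat k)) h →
    U.starNatRel (· < ·) (U.star (nat (k + 1))) h := by
  apply Transfers.mp
  case h =>
    apply_rules [TransfersTerm.var, TransfersTerm.const, Transfers.inOmega, Transfers.countGe,
      Transfers.natRel, Transfers.not, Transfers.imp, Transfers.and, Transfers.or, Transfers.iff,
      Transfers.mem, Transfers.eq, Transfers.exists_extend, Transfers.forall_extend]
  case hP =>
    intro _ h hh hne hk
    obtain ⟨h, rfl⟩ := elem_stage_zero.1 hh
    have hk : k < h := natRel_nat.1 hk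
    exact natRel_nat.2 (lt_of_le_of_ne hk fun e => hne (congrArg nat e.symm))

theorem IsHyperfiniteInteger.lt {H : U.Ext} (hH : U.IsHyperfiniteInteger H) (k : ℕ) :
    U.starNatRel (· < ·) (U.star (nat k)) H := by
  induction k with
  | zero => exact natRel_zero_lt H hH.1 (hH.2 0)
  | succ k ih => exact natRel_succ_lt k H hH.1 (hH.2 _) ih

/-! ### Transferred counting inequalities -/

theorem countGe_zero : ∀ h A : U.Ext, Elem h (U.star (stage 0)) → Elem A (U.star natPowerset) →
    (∀ x, Elem x A → U.InOmega h x) → U.CountGe 0 1 h A := by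
  apply Transfers.mp
  case h =>
    apply_rules [TransfersTerm.var, TransfersTerm.const, Transfers.inOmega, Transfers.countGe,
      Transfers.natRel, Transfers.not, Transfers.imp, Transfers.and, Transfers.or, Transfers.iff,
      Transfers.mem, Transfers.eq, Transfers.exists_extend, Transfers.forall_extend]
  case hP =>
    intro _ h A hh hA hs
    obtain ⟨h, rfl⟩ := elem_stage_zero.1 hh
    obtain ⟨A, rfl⟩ := elem_natPowerset.1 hA
    exact countGe_iff.2 ⟨(Set.finite_Icc 1 h).subset (subset_Icc_of_forall hs), by simp⟩

theorem countGe_one : ∀ h A : U.Ext, Elem h (U.star (stage 0)) → Elem A (U.star natPowerset) →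
    (∀ x, Elem x A ↔ U.InOmega h x) → U.CountGe 1 1 h A := by
  apply Transfers.mp
  case h =>
    apply_rules [TransfersTerm.var, TransfersTerm.const, Transfers.inOmega, Transfers.countGe,
      Transfers.natRel, Transfers.not, Transfers.imp, Transfers.and, Transfers.or, Transfers.iff,
      Transfers.mem, Transfers.eq, Transfers.exists_extend, Transfers.forall_extend]
  case hP =>
    intro _ h A hh hA hs
    obtain ⟨h, rfl⟩ := elem_stage_zero.1 hh
    obtain ⟨A, rfl⟩ := elem_natPowerset.1 hA
    have hA : A = Set.Icc 1 h := by
      ext k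
      rw [← inOmega_nat, ← nat_elem_natSet]
      exact hs _
    subst hA
    refine countGe_iff.2 ⟨Set.finite_Icc 1 h, ?_⟩
    rw [← Finset.coe_Icc, Set.ncard_coe_finset]
    simp

theorem not_countGe_of_lt {p q : ℕ} (hpq : q < p) : ∀ h A : U.Ext, Elem h (U.star (stage 0)) →
    Elem A (U.star natPowerset) → (∀ x, Elem x A → U.InOmega h x) →
    U.starNatRel (· < ·) (U.star (nat 0)) h → ¬ U.CountGe p q h A := by
  apply Transfers.mp
  case h =>
    apply_rules [TransfersTerm.var, TransfersTerm.const, Transfers.inOmega, Transfers.countGe,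
      Transfers.natRel, Transfers.not, Transfers.imp, Transfers.and, Transfers.or, Transfers.iff,
      Transfers.mem, Transfers.eq, Transfers.exists_extend, Transfers.forall_extend]
  case hP =>
    intro _ h A hh hA hs h0 hc
    obtain ⟨h, rfl⟩ := elem_stage_zero.1 hh
    obtain ⟨A, rfl⟩ := elem_natPowerset.1 hA
    have h0 := natRel_nat.1 h0
    have hA := Set.ncard_le_ncard (subset_Icc_of_forall hs) (Set.finite_Icc 1 h)
    rw [← Finset.coe_Icc, Set.ncard_coe_finset, Nat.card_Icc, Nat.add_sub_cancel] at hA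
    have hc := (countGe_iff.1 hc).2
    nlinarith

theorem countGe_of_le {p q p' q' : ℕ} (hq : 0 < q') (hpq : p * q' ≤ p' * q) : ∀ h A : U.Ext,
    Elem h (U.star (stage 0)) → Elem A (U.star natPowerset) →
    U.CountGe p' q' h A → U.CountGe p q h A := by
  apply Transfers.mp
  case h =>
    apply_rules [TransfersTerm.var, TransfersTerm.const, Transfers.inOmega, Transfers.countGe,
      Transfers.natRel, Transfers.not, Transfers.imp, Transfers.and, Transfers.or, Transfers.iff,
      Transfers.mem, Transfers.eq, Transfers.exists_extend, Transfers.forall_extend]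
  case hP =>
    intro _ h A hh hA hc
    obtain ⟨h, rfl⟩ := elem_stage_zero.1 hh
    obtain ⟨A, rfl⟩ := elem_natPowerset.1 hA
    obtain ⟨hf, hc⟩ := countGe_iff.1 hc
    refine countGe_iff.2 ⟨hf, le_of_mul_le_mul_left ?_ hq⟩
    calc q' * (p * h) = p * q' * h := by ring
      _ ≤ p' * q * h := Nat.mul_le_mul_right h hpq
      _ = q * (p' * h) := by ring
      _ ≤ q * (q' * A.ncard) := Nat.mul_le_mul_left q hc
      _ = q' * (q * A.ncard) := by ring

theorem countGe_add {p q p' q' : ℕ} : ∀ h A B C : U.Ext,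
    Elem h (U.star (stage 0)) → Elem A (U.star natPowerset) → Elem B (U.star natPowerset) →
    Elem C (U.star natPowerset) → (∀ x, Elem x C → U.InOmega h x) →
    (∀ x, Elem x A → Elem x C) → (∀ x, Elem x B → Elem x C) → (∀ x, Elem x A → ¬ Elem x B) →
    U.CountGe p q h A → U.CountGe p' q' h B → U.CountGe (p * q' + p' * q) (q * q') h C := by
  apply Transfers.mp
  case h =>
    repeat' apply_rules [TransfersTerm.var, TransfersTerm.const, Transfers.inOmega,
      Transfers.countGe, Transfers.natRel, Transfers.not, Transfers.imp, Transfers.and, Transfers.or, Transfers.iff,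
      Transfers.mem, Transfers.eq, Transfers.exists_extend, Transfers.forall_extend]
  case hP =>
    intro _ h A B C hh hA hB hC hs hAC hBC hAB cA cB
    obtain ⟨h, rfl⟩ := elem_stage_zero.1 hh
    obtain ⟨A, rfl⟩ := elem_natPowerset.1 hA
    obtain ⟨B, rfl⟩ := elem_natPowerset.1 hB
    obtain ⟨C, rfl⟩ := elem_natPowerset.1 hC
    obtain ⟨fA, cA⟩ := countGe_iff.1 cA
    obtain ⟨fB, cB⟩ := countGe_iff.1 cB
    have fC := (Set.finite_Icc 1 h).subset (subset_Icc_of_forall hs)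
    refine countGe_iff.2 ⟨fC, ?_⟩
    have hU : (A ∪ B).ncard = A.ncard + B.ncard := by
      refine Set.ncard_union_eq (Set.disjoint_left.2 fun k hk hk' => ?_) fA fB
      exact hAB _ (nat_elem_natSet.2 hk) (nat_elem_natSet.2 hk')
    have hle : A.ncard + B.ncard ≤ C.ncard := by
      rw [← hU]
      refine Set.ncard_le_ncard (Set.union_subset (fun k hk => ?_) fun k hk => ?_) fC
      · exact nat_elem_natSet.1 (hAC _ (nat_elem_natSet.2 hk))
      · exact nat_elem_natSet.1 (hBC _ (nat_elem_natSet.2 hk))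
    calc (p * q' + p' * q) * h = q' * (p * h) + q * (p' * h) := by ring
      _ ≤ q' * (q * A.ncard) + q * (q' * B.ncard) := by gcongr
      _ = q * q' * (A.ncard + B.ncard) := by ring
      _ ≤ q * q' * C.ncard := Nat.mul_le_mul_left _ hle

/-- For finite sets a failed lower bound is a strict upper bound, and strict upper bounds add over a
common denominator. This is the source of subadditivity, as `countGe_add` is of superadditivity. -/
theorem not_countGe_add {p q p' q' : ℕ} (hq : 0 < q) (hq' : 0 < q') : ∀ h A B C : U.Ext,
    Elem h (U.star (stage 0)) → Elem A (U.star natPowerset) → Elem B (U.star natPowerset) →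
    Elem C (U.star natPowerset) → (∀ x, Elem x A → U.InOmega h x) →
    (∀ x, Elem x B → U.InOmega h x) → (∀ x, Elem x C → Elem x A ∨ Elem x B) →
    ¬ U.CountGe p q h A → ¬ U.CountGe p' q' h B →
    ¬ U.CountGe (p * q' + p' * q) (q * q') h C := by
  apply Transfers.mp
  case h =>
    repeat' apply_rules [TransfersTerm.var, TransfersTerm.const, Transfers.inOmega,
      Transfers.countGe, Transfers.natRel, Transfers.not, Transfers.imp, Transfers.and, Transfers.or, Transfers.iff,
      Transfers.mem, Transfers.eq, Transfers.exists_extend, Transfers.forall_extend]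
  case hP =>
    intro _ h A B C hh hA hB hC sA sB hAB cA cB cC
    obtain ⟨h, rfl⟩ := elem_stage_zero.1 hh
    obtain ⟨A, rfl⟩ := elem_natPowerset.1 hA
    obtain ⟨B, rfl⟩ := elem_natPowerset.1 hB
    obtain ⟨C, rfl⟩ := elem_natPowerset.1 hC
    have fA := (Set.finite_Icc 1 h).subset (subset_Icc_of_forall sA)
    have fB := (Set.finite_Icc 1 h).subset (subset_Icc_of_forall sB)
    have cA : q * A.ncard < p * h := lt_of_not_ge fun hc => cA (countGe_iff.2 ⟨fA, hc⟩)
    have cB : q' * B.ncard < p' * h := lt_of_not_ge fun hc => cB (countGe_iff.2 ⟨fB, hc⟩)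
    have cC := (countGe_iff.1 cC).2
    have hle : C.ncard ≤ A.ncard + B.ncard := by
      refine (Set.ncard_le_ncard (fun k hk => ?_) (fA.union fB)).trans (Set.ncard_union_le A B)
      refine (hAB _ (nat_elem_natSet.2 hk)).imp ?_ ?_ <;> exact nat_elem_natSet.1
    refine absurd cC (not_le.2 ?_)
    calc q * q' * C.ncard ≤ q * q' * (A.ncard + B.ncard) := Nat.mul_le_mul_left _ hle
      _ = q' * (q * A.ncard) + q * (q' * B.ncard) := by ring
      _ < q' * (p * h) + q * (p' * h) := by gcongr
      _ = (p * q' + p' * q) * h := by ring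

/-! ### Frequency of residue classes -/

theorem ncard_mod_bounds (h n m : ℕ) (hn : 0 < n) (hm : m < n) :
    h ≤ n * {k ∈ Set.Icc 1 h | k % n = m}.ncard + n ∧
    n * {k ∈ Set.Icc 1 h | k % n = m}.ncard ≤ h + n := by
  have e : {k ∈ Set.Icc 1 h | k % n = m} = ((Finset.Ioc 0 h).filter (· ≡ m [MOD n]) : Set ℕ) := by
    ext k
    simp [Nat.ModEq, Nat.mod_eq_of_lt hm, Nat.succ_le_iff]
  rw [e, Set.ncard_coe_finset]
  have hc := Nat.Ioc_filter_modEq_card 0 h hn m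
  have hn' : (0 : ℚ) < n := by exact_mod_cast hn
  set c := ((Finset.Ioc 0 h).filter (· ≡ m [MOD n])).card
  set x := ((h - m : ℚ) / n)
  have hx : x * n = h - m := div_mul_cancel₀ _ hn'.ne'
  have hm' : (m : ℚ) < n := by exact_mod_cast hm
  have hm0 : (0 : ℚ) ≤ m := m.cast_nonneg
  -- The count is a difference of two floors; the one at the left endpoint 0 is that of -m/n, which
  -- lies in (-1, 0].
  have hf : ⌊((0 : ℕ) - m : ℚ) / n⌋ = if m = 0 then 0 else -1 := by
    split_ifs with h0
    · simp [h0]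
    · have : (0 : ℚ) < m := by exact_mod_cast Nat.pos_of_ne_zero h0
      rw [Int.floor_eq_iff]
      constructor
      · rw [le_div_iff₀ hn']; push_cast; linarith
      · rw [div_lt_iff₀ hn']; push_cast; linarith
  have hx1 := Int.floor_le x
  have hx2 := Int.lt_floor_add_one x
  rw [hf] at hc
  have hc' : (c : ℚ) = max ((⌊x⌋ : ℚ) - if m = 0 then 0 else -1) 0 := by
    have := congrArg (Int.cast : ℤ → ℚ) hc
    push_cast at this
    exact this
  have hh : (0 : ℚ) ≤ h := h.cast_nonneg
  constructor
  · suffices (h : ℚ) ≤ n * c + n by exact_mod_cast this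
    have h1 := le_max_left ((⌊x⌋ : ℚ) - if m = 0 then 0 else -1) 0
    rw [← hc'] at h1
    split_ifs at h1 with h0
    · subst h0
      push_cast at hx
      nlinarith
    · nlinarith
  · suffices (n * c : ℚ) ≤ h + n by exact_mod_cast this
    rcases max_choice ((⌊x⌋ : ℚ) - if m = 0 then 0 else -1) 0 with h1 | h1
    · rw [h1] at hc'
      rw [hc']
      split_ifs with h0 <;> nlinarith
    · rw [h1] at hc'
      rw [hc']
      linarith

/-- Rounding costs at most q·n after clearing denominators. The integer gap q - p·n is at least 1,
so the main term gains at least h > q·n. The upper estimate `not_countGe_mod` has the same balance.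
-/
theorem countGe_mod {p q n m : ℕ} (hm : m < n) (hpq : p * n < q) : ∀ h A : U.Ext,
    Elem h (U.star (stage 0)) → Elem A (U.star natPowerset) →
    (∀ x, Elem x A ↔ U.InOmega h x ∧ Elem x (U.star (natSet {k | k % n = m}))) →
    U.starNatRel (· < ·) (U.star (nat (q * n))) h → U.CountGe p q h A := by
  apply Transfers.mp
  case h =>
    apply_rules [TransfersTerm.var, TransfersTerm.const, Transfers.inOmega, Transfers.countGe,
      Transfers.natRel, Transfers.not, Transfers.imp, Transfers.and, Transfers.or, Transfers.iff,
      Transfers.mem, Transfers.eq, Transfers.exists_extend, Transfers.forall_extend]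
  case hP =>
    intro _ h A hh hA hs hlt
    obtain ⟨h, rfl⟩ := elem_stage_zero.1 hh
    obtain ⟨A, rfl⟩ := elem_natPowerset.1 hA
    obtain rfl : A = {k ∈ Set.Icc 1 h | k % n = m} := by
      ext k
      refine nat_elem_natSet.symm.trans ((hs (nat k)).trans (and_congr inOmega_nat ?_))
      exact nat_elem_natSet
    have hlt : q * n < h := natRel_nat.1 hlt
    refine countGe_iff.2 ⟨(Set.finite_Icc 1 h).subset (Set.sep_subset _ _), ?_⟩
    have hn : 0 < n := by omega
    have hb := (ncard_mod_bounds h n m hn hm).1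
    refine le_of_mul_le_mul_left ?_ hn
    nlinarith

theorem not_countGe_mod {p q n m : ℕ} (hm : m < n) (hpq : q < p * n) : ∀ h A : U.Ext,
    Elem h (U.star (stage 0)) → Elem A (U.star natPowerset) →
    (∀ x, Elem x A ↔ U.InOmega h x ∧ Elem x (U.star (natSet {k | k % n = m}))) →
    U.starNatRel (· < ·) (U.star (nat (q * n))) h → ¬ U.CountGe p q h A := by
  apply Transfers.mp
  case h =>
    apply_rules [TransfersTerm.var, TransfersTerm.const, Transfers.inOmega, Transfers.countGe,
      Transfers.natRel, Transfers.not, Transfers.imp, Transfers.and, Transfers.or, Transfers.iff,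
      Transfers.mem, Transfers.eq, Transfers.exists_extend, Transfers.forall_extend]
  case hP =>
    intro _ h A hh hA hs hlt hc
    obtain ⟨h, rfl⟩ := elem_stage_zero.1 hh
    obtain ⟨A, rfl⟩ := elem_natPowerset.1 hA
    obtain rfl : A = {k ∈ Set.Icc 1 h | k % n = m} := by
      ext k
      refine nat_elem_natSet.symm.trans ((hs (nat k)).trans (and_congr inOmega_nat ?_))
      exact nat_elem_natSet
    have hlt : q * n < h := natRel_nat.1 hlt
    have hc := (countGe_iff.1 hc).2
    have hn : 0 < n := by omega
    have hb := (ncard_mod_bounds h n m hn hm).2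
    have h1 : n * (p * h) ≤ q * (h + n) := by
      calc n * (p * h) ≤ n * (q * _) := Nat.mul_le_mul_left n hc
        _ = q * (n * _) := by ring
        _ ≤ q * (h + n) := Nat.mul_le_mul_left q hb
    nlinarith

end NonstandardUniverse

/-! ### Standard parts of internal probabilities -/

theorem exists_nat_div_btwn {a b : ℝ} (ha : 0 ≤ a) (hab : a < b) :
    ∃ p q : ℕ, 0 < q ∧ a < (p : ℝ) / q ∧ (p : ℝ) / q < b := by
  obtain ⟨r, h1, h2⟩ := exists_rat_btwn hab
  have hr : 0 ≤ r.num := Rat.num_nonneg.2 (by exact_mod_cast ha.trans h1.le)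
  have e : ((r.num.toNat : ℕ) : ℝ) / (r.den : ℝ) = r := by
    have : ((r.num.toNat : ℕ) : ℝ) = r.num := by exact_mod_cast Int.toNat_of_nonneg hr
    rw [this]
    exact_mod_cast Rat.num_div_den r
  exact ⟨r.num.toNat, r.den, r.den_pos, by rwa [e], by rwa [e]⟩

namespace NonstandardUniverse

open Superstructure

variable {U : NonstandardUniverse.{u}} {H A B C : U.Ext}

/-- Turns the definition through the truncation and the type Ω into a first-order condition that
matches the transferred lemmas. -/
theorem mem_internalPowerset :
    A ∈ U.internalPowerset H ↔ Elem A (U.star natPowerset) ∧ ∀ x, Elem x A → U.InOmega H x := by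
  constructor
  · rintro ⟨⟨n, hn⟩, h0, h⟩
    have h' : ∀ x, Elem x A → U.InOmega H x := fun x hx => by
      obtain ⟨ω, rfl⟩ := h x hx
      exact ω.2
    exact ⟨elem_natPowerset_of_elem_stage A hn h0 fun y hy => (h' y hy).1, h'⟩
  · rintro ⟨hA, h⟩
    obtain ⟨h1, h2⟩ := elem_stage_one_of_elem_natPowerset A hA
    exact ⟨⟨1, h1⟩, h2, fun x hx => ⟨⟨x, h x hx⟩, rfl⟩⟩

theorem exists_diff_mem (hA : A ∈ U.internalPowerset H) (hB : Elem B (U.star natPowerset)) :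
    ∃ C ∈ U.internalPowerset H, ∀ x, Elem x C ↔ Elem x A ∧ ¬ Elem x B := by
  rw [mem_internalPowerset] at hA
  obtain ⟨C, hC, h⟩ := exists_diff A B hA.1 hB
  exact ⟨C, mem_internalPowerset.2 ⟨hC, fun x hx => hA.2 x ((h x).1 hx).1⟩, h⟩

theorem exists_inter_mem (hA : A ∈ U.internalPowerset H) (hB : Elem B (U.star natPowerset)) :
    ∃ C ∈ U.internalPowerset H, ∀ x, Elem x C ↔ Elem x A ∧ Elem x B := by
  obtain ⟨C, hC, h⟩ := exists_diff_mem hA hB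
  obtain ⟨D, hD, h'⟩ := exists_diff_mem hA (mem_internalPowerset.1 hC).1
  exact ⟨D, hD, fun x => by rw [h', h]; tauto⟩

theorem exists_omega_mem (hH : U.IsHyperfiniteInteger H) :
    ∃ A ∈ U.internalPowerset H, ∀ x, Elem x A ↔ U.InOmega H x := by
  obtain ⟨A, hA, h⟩ := exists_omega H hH.1
  exact ⟨A, mem_internalPowerset.2 ⟨hA, fun x => (h x).1⟩, h⟩

theorem IsHyperfiniteInteger.stProb_bddAbove (hH : U.IsHyperfiniteInteger H)
    (hA : A ∈ U.internalPowerset H) :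
    ∀ r ∈ {r : ℝ | ∃ p q : ℕ, 0 < q ∧ r = (p : ℝ) / (q : ℝ) ∧ U.CountGe p q H A}, r ≤ 1 := by
  rw [mem_internalPowerset] at hA
  rintro _ ⟨p, q, hq, rfl, h⟩
  rw [div_le_one (by exact_mod_cast hq)]
  by_contra hlt
  exact not_countGe_of_lt (by exact_mod_cast not_le.1 hlt) H A hH.1 hA.1 hA.2 (hH.lt 0) h

theorem IsHyperfiniteInteger.stProb_nonempty (hH : U.IsHyperfiniteInteger H)
    (hA : A ∈ U.internalPowerset H) :
    (0 : ℝ) ∈ {r : ℝ | ∃ p q : ℕ, 0 < q ∧ r = (p : ℝ) / (q : ℝ) ∧ U.CountGe p q H A} := by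
  rw [mem_internalPowerset] at hA
  exact ⟨0, 1, one_pos, by simp, countGe_zero H A hH.1 hA.1 hA.2⟩

theorem IsHyperfiniteInteger.le_stProb (hH : U.IsHyperfiniteInteger H)
    (hA : A ∈ U.internalPowerset H) {p q : ℕ} (hq : 0 < q) (h : U.CountGe p q H A) :
    (p : ℝ) / q ≤ U.stProb H A :=
  le_csSup ⟨1, hH.stProb_bddAbove hA⟩ ⟨p, q, hq, rfl, h⟩

/-- A larger fraction that is attained would make p/q attained too, so a failed bound is an upper
bound of the supremum. -/
theorem IsHyperfiniteInteger.stProb_le (hH : U.IsHyperfiniteInteger H)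
    (hA : A ∈ U.internalPowerset H) {p q : ℕ} (hq : 0 < q) (h : ¬ U.CountGe p q H A) :
    U.stProb H A ≤ (p : ℝ) / q := by
  refine csSup_le ⟨0, hH.stProb_nonempty hA⟩ ?_
  rintro _ ⟨p', q', hq', rfl, h'⟩
  by_contra hlt
  rw [not_le, div_lt_div_iff₀ (by exact_mod_cast hq) (by exact_mod_cast hq')] at hlt
  exact h (countGe_of_le hq' (by exact_mod_cast hlt.le) H A hH.1 (mem_internalPowerset.1 hA).1 h')

theorem IsHyperfiniteInteger.stProb_nonneg (hH : U.IsHyperfiniteInteger H)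
    (hA : A ∈ U.internalPowerset H) : 0 ≤ U.stProb H A :=
  le_csSup ⟨1, hH.stProb_bddAbove hA⟩ (hH.stProb_nonempty hA)

theorem IsHyperfiniteInteger.stProb_le_one (hH : U.IsHyperfiniteInteger H)
    (hA : A ∈ U.internalPowerset H) : U.stProb H A ≤ 1 :=
  csSup_le ⟨0, hH.stProb_nonempty hA⟩ (hH.stProb_bddAbove hA)

theorem IsHyperfiniteInteger.stProb_omega (hH : U.IsHyperfiniteInteger H)
    (hA : A ∈ U.internalPowerset H) (h : ∀ x, Elem x A ↔ U.InOmega H x) :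
    U.stProb H A = 1 := by
  refine (hH.stProb_le_one hA).antisymm ?_
  have := hH.le_stProb hA one_pos (countGe_one H A hH.1 (mem_internalPowerset.1 hA).1 h)
  simpa using this

theorem IsHyperfiniteInteger.stProb_mod (hH : U.IsHyperfiniteInteger H)
    (hA : A ∈ U.internalPowerset H) {n m : ℕ} (hm : m < n)
    (h : ∀ x, Elem x A ↔ U.InOmega H x ∧ Elem x (U.star (natSet {k | k % n = m}))) :
    U.stProb H A = (n : ℝ)⁻¹ := by
  have hn : (0 : ℝ) < n := by exact_mod_cast Nat.zero_lt_of_lt hm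
  have hA' := (mem_internalPowerset.1 hA).1
  refine le_antisymm (not_lt.1 fun hlt => ?_) (not_lt.1 fun hlt => ?_)
  · obtain ⟨p, q, hq, h1, h2⟩ := exists_nat_div_btwn (by positivity) hlt
    rw [inv_eq_one_div, div_lt_div_iff₀ hn (by exact_mod_cast hq), one_mul] at h1
    exact h2.not_ge (hH.stProb_le hA hq
      (not_countGe_mod hm (by exact_mod_cast h1) H A hH.1 hA' h (hH.lt _)))
  · obtain ⟨p, q, hq, h1, h2⟩ := exists_nat_div_btwn (hH.stProb_nonneg hA) hlt
    rw [inv_eq_one_div, div_lt_div_iff₀ (by exact_mod_cast hq) hn, one_mul] at h2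
    exact h1.not_ge (hH.le_stProb hA hq
      (countGe_mod hm (by exact_mod_cast h2) H A hH.1 hA' h (hH.lt _)))

theorem IsHyperfiniteInteger.stProb_superadditive (hH : U.IsHyperfiniteInteger H)
    (hA : A ∈ U.internalPowerset H) (hB : B ∈ U.internalPowerset H)
    (hC : C ∈ U.internalPowerset H) (hAC : ∀ x, Elem x A → Elem x C)
    (hBC : ∀ x, Elem x B → Elem x C) (hAB : ∀ x, Elem x A → ¬ Elem x B) :
    U.stProb H A + U.stProb H B ≤ U.stProb H C := by
  rw [← le_sub_iff_add_le]
  refine csSup_le ⟨0, hH.stProb_nonempty hA⟩ ?_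
  rintro _ ⟨p, q, hq, rfl, h⟩
  rw [le_sub_comm]
  refine csSup_le ⟨0, hH.stProb_nonempty hB⟩ ?_
  rintro _ ⟨p', q', hq', rfl, h'⟩
  rw [le_sub_iff_add_le', div_add_div _ _ (by positivity) (by positivity)]
  rw [mem_internalPowerset] at hA hB
  have hC' := mem_internalPowerset.1 hC
  have := hH.le_stProb hC (Nat.mul_pos hq hq')
    (countGe_add H A B C hH.1 hA.1 hB.1 hC'.1 hC'.2 hAC hBC hAB h h')
  push_cast at this
  rwa [mul_comm (p' : ℝ) q] at this

theorem IsHyperfiniteInteger.stProb_subadditive (hH : U.IsHyperfiniteInteger H)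
    (hA : A ∈ U.internalPowerset H) (hB : B ∈ U.internalPowerset H)
    (hC : C ∈ U.internalPowerset H) (h : ∀ x, Elem x C → Elem x A ∨ Elem x B) :
    U.stProb H C ≤ U.stProb H A + U.stProb H B := by
  refine le_of_forall_pos_le_add fun ε hε => ?_
  -- A rational just above the standard part is not attained, and unattained bounds add up.
  obtain ⟨p, q, hq, h1, h2⟩ := exists_nat_div_btwn (hH.stProb_nonneg hA)
    (lt_add_of_pos_right (U.stProb H A) (half_pos hε))
  obtain ⟨p', q', hq', h1', h2'⟩ := exists_nat_div_btwn (hH.stProb_nonneg hB)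
    (lt_add_of_pos_right (U.stProb H B) (half_pos hε))
  have hn : ¬ U.CountGe p q H A := fun hc => h1.not_ge (hH.le_stProb hA hq hc)
  have hn' : ¬ U.CountGe p' q' H B := fun hc => h1'.not_ge (hH.le_stProb hB hq' hc)
  rw [mem_internalPowerset] at hA hB
  have := hH.stProb_le hC (Nat.mul_pos hq hq') (not_countGe_add hq hq' H A B C hH.1 hA.1 hB.1
    (mem_internalPowerset.1 hC).1 hA.2 hB.2 h hn hn')
  have e : (p : ℝ) / q + p' / q' = (p * q' + p' * q) / (q * q') := by
    rw [div_add_div _ _ (by positivity) (by positivity), mul_comm (p' : ℝ) q]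
  push_cast at this
  linarith

theorem IsHyperfiniteInteger.stProb_mono (hH : U.IsHyperfiniteInteger H)
    (hA : A ∈ U.internalPowerset H) (hB : B ∈ U.internalPowerset H)
    (h : ∀ x, Elem x A → Elem x B) : U.stProb H A ≤ U.stProb H B := by
  obtain ⟨C, hC, hC'⟩ := exists_diff_mem hB (mem_internalPowerset.1 hA).1
  have := hH.stProb_superadditive hA hC hB h (fun x hx => ((hC' x).1 hx).1)
    (fun x hx hx' => ((hC' x).1 hx').2 hx)
  linarith [hH.stProb_nonneg hC]

theorem IsHyperfiniteInteger.stProb_empty (hH : U.IsHyperfiniteInteger H)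
    (hA : A ∈ U.internalPowerset H) (h : ∀ x, ¬ Elem x A) : U.stProb H A = 0 := by
  -- The empty set is disjoint from itself, so twice its probability is at most its probability.
  have := hH.stProb_superadditive hA hA hA (fun _ => id) (fun _ => id) fun x hx => (h x hx).elim
  linarith [hH.stProb_nonneg hA]

theorem IsHyperfiniteInteger.stProb_le_sum (hH : U.IsHyperfiniteInteger H)
    {D : ℕ → U.Ext} (hD : ∀ i, D i ∈ U.internalPowerset H)
    (n : ℕ) (hA : A ∈ U.internalPowerset H) (h : ∀ x, Elem x A → ∃ i < n, Elem x (D i)) :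
    U.stProb H A ≤ ∑ i ∈ Finset.range n, U.stProb H (D i) := by
  induction n generalizing A with
  | zero =>
    rw [hH.stProb_empty hA fun x hx => by obtain ⟨i, hi, -⟩ := h x hx; omega]
    simp
  | succ n ih =>
    obtain ⟨C, hC, hC'⟩ := exists_diff_mem hA (mem_internalPowerset.1 (hD n)).1
    rw [Finset.sum_range_succ]
    refine (hH.stProb_subadditive hC (hD n) hA fun x hx => ?_).trans
      (add_le_add_left (ih hC fun x hx => ?_) _)
    · rw [hC']; tauto
    · obtain ⟨hx, hn⟩ := (hC' x).1 hx
      obtain ⟨i, hi, hxi⟩ := h x hx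
      exact ⟨i, lt_of_le_of_ne (Nat.lt_succ_iff.1 hi) (by rintro rfl; exact hn hxi), hxi⟩

end NonstandardUniverse

/-! ### The Loeb measure of internal sets -/

namespace NonstandardUniverse

open Superstructure

variable {U : NonstandardUniverse.{u}} {H A B C : U.Ext} {κ : Cardinal.{u}}

/-- Saturation only yields a point of `*V`; a member of the nonempty family forces it into Ω. -/
theorem IsSaturated.exists_forall_mem (hU : U.IsSaturated κ) {F : Set U.Ext}
    (hF : F ⊆ U.internalPowerset H) (hcard : #F < κ) (hne : F.Nonempty)
    (h : ∀ G : Set U.Ext, G ⊆ F → G.Finite → ∃ ω : U.Omega H, ∀ A ∈ G, Elem ω.1 A) :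
    ∃ ω : U.Omega H, ∀ A ∈ F, Elem ω.1 A := by
  obtain ⟨x, -, hx⟩ := hU F (fun A hA => (hF hA).1) hcard fun G hG => by
    obtain ⟨ω, hω⟩ := h G hG G.finite_toSet
    exact ⟨ω.1, ⟨0, ω.2.1⟩, hω⟩
  obtain ⟨A, hA⟩ := hne
  exact ⟨⟨x, (mem_internalPowerset.1 (hF hA)).2 x (hx A hA)⟩, hx⟩

/-- Without a finite subcover the countably many internal sets A ∖ D_i have the finite intersection
property, and saturation produces an uncovered point. -/
theorem IsSaturated.exists_finite_subcover (hU : U.IsSaturated κ) (hκ : ℵ₀ < κ) {D : ℕ → U.Ext}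
    (hA : A ∈ U.internalPowerset H) (hD : ∀ i, D i ∈ U.internalPowerset H)
    (h : ∀ ω : U.Omega H, Elem ω.1 A → ∃ i, Elem ω.1 (D i)) :
    ∃ n, ∀ x, Elem x A → ∃ i < n, Elem x (D i) := by
  by_contra! hn
  choose B hB hB' using fun i => exists_diff_mem hA (mem_internalPowerset.1 (hD i)).1
  obtain ⟨ω, hω⟩ := hU.exists_forall_mem (F := Set.range B) (H := H)
    (by rintro _ ⟨i, rfl⟩; exact hB i) ((Set.countable_range B).le_aleph0.trans_lt hκ)
    (Set.range_nonempty B) fun G hG hf => by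
      choose! g hg using fun B' (hB' : B' ∈ G) => hG hB'
      obtain ⟨n, hn'⟩ := (hf.image g).bddAbove
      obtain ⟨x, hx, hx'⟩ := hn (n + 1)
      refine ⟨⟨x, (mem_internalPowerset.1 hA).2 x hx⟩, fun B' hB'G => ?_⟩
      rw [← hg B' hB'G, hB']
      exact ⟨hx, hx' _ (Nat.lt_succ_of_le (hn' (Set.mem_image_of_mem g hB'G)))⟩
  simp only [Set.forall_mem_range, hB'] at hω
  obtain ⟨i, hi⟩ := h ω (hω 0).1
  exact (hω i).2 hi

variable (H) in
/-- The standard part of the internal probability, extended by `∞` to external sets. -/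
noncomputable def preLoeb (S : Set (U.Omega H)) : ℝ≥0∞ :=
  ⨅ A ∈ U.internalPowerset H, ⨅ _ : U.toSet A = S, ENNReal.ofReal (U.stProb H A)

theorem toSet_subset_iff (hA : A ∈ U.internalPowerset H) :
    (U.toSet A : Set (U.Omega H)) ⊆ U.toSet B ↔ ∀ x, Elem x A → Elem x B :=
  ⟨fun h x hx => h (a := ⟨x, (mem_internalPowerset.1 hA).2 x hx⟩) hx, fun h _ hω => h _ hω⟩

theorem IsHyperfiniteInteger.preLoeb_toSet (hH : U.IsHyperfiniteInteger H)
    (hA : A ∈ U.internalPowerset H) :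
    preLoeb H (U.toSet A) = ENNReal.ofReal (U.stProb H A) := by
  refine le_antisymm (iInf₂_le_of_le A hA (iInf_le _ rfl)) ?_
  refine le_iInf₂ fun B hB => le_iInf fun e => ENNReal.ofReal_le_ofReal ?_
  exact hH.stProb_mono hA hB ((toSet_subset_iff hA).1 e.ge)

theorem exists_of_preLoeb_ne_top {S : Set (U.Omega H)} (h : preLoeb H S ≠ ∞) :
    ∃ A ∈ U.internalPowerset H, U.toSet A = S := by
  by_contra! hn
  refine h ?_
  simp only [preLoeb, iInf_eq_top]
  exact fun A hA e => (hn A hA e).elim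

theorem IsHyperfiniteInteger.exists_empty_mem (hH : U.IsHyperfiniteInteger H) :
    ∃ A ∈ U.internalPowerset H, ∀ x, ¬ Elem x A := by
  obtain ⟨A, hA, -⟩ := exists_omega_mem hH
  obtain ⟨B, hB, h⟩ := exists_diff_mem hA (mem_internalPowerset.1 hA).1
  exact ⟨B, hB, fun x hx => ((h x).1 hx).2 ((h x).1 hx).1⟩

/-- A countable cover which occurs in the definition of the Loeb outer measure with a finite sum
consists of internal sets. -/
theorem IsHyperfiniteInteger.exists_internal_cover (hH : U.IsHyperfiniteInteger H)
    {t : ℕ → Set (U.Omega H)} (h : ∑' n, ⨆ _ : (t n).Nonempty, preLoeb H (t n) ≠ ∞) :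
    ∃ D : ℕ → U.Ext, (∀ n, D n ∈ U.internalPowerset H) ∧ (∀ n, U.toSet (D n) = t n) ∧
      ∑' n, ENNReal.ofReal (U.stProb H (D n)) = ∑' n, ⨆ _ : (t n).Nonempty, preLoeb H (t n) := by
  have key : ∀ n, ∃ A ∈ U.internalPowerset H, U.toSet A = t n ∧
      ENNReal.ofReal (U.stProb H A) = ⨆ _ : (t n).Nonempty, preLoeb H (t n) := by
    intro n
    have hn := ENNReal.ne_top_of_tsum_ne_top h n
    rcases (t n).eq_empty_or_nonempty with h0 | h0
    · obtain ⟨A, hA, hA'⟩ := hH.exists_empty_mem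
      exact ⟨A, hA, by rw [h0]; exact Set.eq_empty_of_forall_notMem fun ω => hA' ω.1,
        by simp [hH.stProb_empty hA hA', h0]⟩
    · rw [ciSup_pos h0] at hn ⊢
      obtain ⟨A, hA, e⟩ := exists_of_preLoeb_ne_top hn
      exact ⟨A, hA, e, by rw [← e, hH.preLoeb_toSet hA]⟩
  choose D hD hD' hD'' using key
  exact ⟨D, hD, hD', tsum_congr hD''⟩

/-- A countable internal cover of an internal set has a finite subcover, so finite subadditivity
already shows that no cover is cheaper than the set itself. -/
theorem IsHyperfiniteInteger.loebOuterMeasure_toSet (hH : U.IsHyperfiniteInteger H)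
    (hU : U.IsSaturated κ) (hκ : ℵ₀ < κ) (hA : A ∈ U.internalPowerset H) :
    U.loebOuterMeasure H (U.toSet A) = ENNReal.ofReal (U.stProb H A) := by
  refine le_antisymm ((OuterMeasure.boundedBy_le _).trans (hH.preLoeb_toSet hA).le) ?_
  change _ ≤ OuterMeasure.boundedBy (preLoeb H) _
  rw [OuterMeasure.boundedBy_apply]
  refine le_iInf₂ fun t ht => ?_
  by_cases htop : ∑' n, ⨆ _ : (t n).Nonempty, preLoeb H (t n) = ∞
  · rw [htop]; exact le_top
  obtain ⟨D, hD, hD', e⟩ := hH.exists_internal_cover htop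
  rw [← e]
  obtain ⟨n, hn⟩ := hU.exists_finite_subcover hκ hA hD fun ω hω => by
    obtain ⟨i, hi⟩ := Set.mem_iUnion.1 (ht hω)
    rw [← hD'] at hi
    exact ⟨i, hi⟩
  calc ENNReal.ofReal (U.stProb H A)
      ≤ ENNReal.ofReal (∑ i ∈ Finset.range n, U.stProb H (D i)) :=
        ENNReal.ofReal_le_ofReal (hH.stProb_le_sum hD n hA hn)
    _ = ∑ i ∈ Finset.range n, ENNReal.ofReal (U.stProb H (D i)) :=
        ENNReal.ofReal_sum_of_nonneg fun i _ => hH.stProb_nonneg (hD i)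
    _ ≤ _ := ENNReal.sum_le_tsum _

/-- Carathéodory's condition need only be tested against internal sets, external ones having
premeasure ∞; there it is finite superadditivity. -/
theorem IsHyperfiniteInteger.measurableSet_toSet (hH : U.IsHyperfiniteInteger H)
    (hA : A ∈ U.internalPowerset H) : MeasurableSet (U.toSet A : Set (U.Omega H)) := by
  refine OuterMeasure.boundedBy_caratheodory (m := preLoeb H) fun t => ?_
  refine le_iInf₂ fun B hB => le_iInf fun e => ?_
  subst e
  obtain ⟨C, hC, hC'⟩ := exists_inter_mem hB (mem_internalPowerset.1 hA).1
  obtain ⟨D, hD, hD'⟩ := exists_diff_mem hB (mem_internalPowerset.1 hA).1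
  have e1 : (U.toSet B ∩ U.toSet A : Set (U.Omega H)) = U.toSet C :=
    Set.ext fun ω => (hC' ω.1).symm
  have e2 : (U.toSet B \ U.toSet A : Set (U.Omega H)) = U.toSet D :=
    Set.ext fun ω => (hD' ω.1).symm
  rw [e1, e2, hH.preLoeb_toSet hC, hH.preLoeb_toSet hD,
    ← ENNReal.ofReal_add (hH.stProb_nonneg hC) (hH.stProb_nonneg hD)]
  refine ENNReal.ofReal_le_ofReal (hH.stProb_superadditive hC hD hB (fun x hx => ((hC' x).1 hx).1)
    (fun x hx => ((hD' x).1 hx).1) fun x hx hx' => ((hD' x).1 hx').2 ((hC' x).1 hx).2)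

theorem IsHyperfiniteInteger.loebMeasure_toSet (hH : U.IsHyperfiniteInteger H)
    (hU : U.IsSaturated κ) (hκ : ℵ₀ < κ) (hA : A ∈ U.internalPowerset H) :
    U.loebMeasure H (U.toSet A) = ENNReal.ofReal (U.stProb H A) := by
  rw [loebMeasure, toMeasure_apply _ _ (hH.measurableSet_toSet hA),
    hH.loebOuterMeasure_toSet hU hκ hA]

theorem IsHyperfiniteInteger.isProbabilityMeasure_loebMeasure (hH : U.IsHyperfiniteInteger H)
    (hU : U.IsSaturated κ) (hκ : ℵ₀ < κ) : IsProbabilityMeasure (U.loebMeasure H) := by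
  obtain ⟨A, hA, h⟩ := exists_omega_mem hH
  have e : (U.toSet A : Set (U.Omega H)) = Set.univ :=
    Set.eq_univ_of_forall fun ω => (h ω.1).2 ω.2
  exact ⟨by rw [← e, hH.loebMeasure_toSet hU hκ hA, hH.stProb_omega hA h, ENNReal.ofReal_one]⟩

theorem IsHyperfiniteInteger.exists_cover_of_loebMeasure_lt (hH : U.IsHyperfiniteInteger H)
    {E : Set (U.Omega H)} (hE : MeasurableSet E) {r : ℝ≥0∞} (hr : U.loebMeasure H E < r) :
    ∃ D : ℕ → U.Ext, (∀ n, D n ∈ U.internalPowerset H) ∧ E ⊆ ⋃ n, U.toSet (D n) ∧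
      ∑' n, ENNReal.ofReal (U.stProb H (D n)) < r := by
  rw [loebMeasure, toMeasure_apply _ _ hE] at hr
  change OuterMeasure.boundedBy (preLoeb H) _ < r at hr
  rw [OuterMeasure.boundedBy_apply] at hr
  simp only [iInf_lt_iff] at hr
  obtain ⟨t, ht, hlt⟩ := hr
  obtain ⟨D, hD, hD', e⟩ := hH.exists_internal_cover hlt.ne_top
  exact ⟨D, hD, by simpa only [hD'] using ht, e ▸ hlt⟩

end NonstandardUniverse

/-! ### The coin tossing measure -/

theorem isPiSystem_cylinder :
    IsPiSystem {S : Set (ℕ → Bool) | ∃ f n, S = PiNat.cylinder f n} := by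
  rintro _ ⟨f, n, rfl⟩ _ ⟨g, m, rfl⟩ ⟨h, hf, hg⟩
  refine ⟨h, max n m, ?_⟩
  rw [← PiNat.mem_cylinder_iff_eq.1 hf, ← PiNat.mem_cylinder_iff_eq.1 hg]
  ext x
  simp only [Set.mem_inter_iff, PiNat.mem_cylinder_iff, lt_max_iff]
  exact ⟨fun h i hi => hi.elim (h.1 i) (h.2 i),
    fun h => ⟨fun i hi => h i (Or.inl hi), fun i hi => h i (Or.inr hi)⟩⟩

theorem coinMeasure_cylinder (f : ℕ → Bool) (n : ℕ) :
    coinMeasure (PiNat.cylinder f n) = (2 ^ n : ℝ≥0∞)⁻¹ := by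
  have e : PiNat.cylinder f n = Set.pi (Finset.range n) fun i => {f i} := by
    ext x
    simp [PiNat.mem_cylinder_iff]
  rw [e, coinMeasure, Measure.infinitePi_pi _ fun i _ => measurableSet_singleton _]
  have h : ∀ b, ProbabilityTheory.uniformOn (Set.univ : Set Bool) {b} = 2⁻¹ := fun b => by
    rw [ProbabilityTheory.uniformOn_univ]
    simp
  simp only [h, Finset.prod_const, Finset.card_range, ENNReal.inv_pow]

theorem generateFrom_cylinder : (MeasurableSpace.pi : MeasurableSpace (ℕ → Bool)) =
    MeasurableSpace.generateFrom {S : Set (ℕ → Bool) | ∃ f n, S = PiNat.cylinder f n} :=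
  (BorelSpace.measurable_eq).trans
    (PiNat.isTopologicalBasis_cylinders fun _ => Bool).borel_eq_generateFrom

theorem eq_coinMeasure {μ : Measure (ℕ → Bool)} [IsProbabilityMeasure μ]
    (h : ∀ f n, μ (PiNat.cylinder f n) = (2 ^ n : ℝ≥0∞)⁻¹) : μ = coinMeasure := by
  have : IsProbabilityMeasure coinMeasure := by unfold coinMeasure; infer_instance
  refine ext_of_generate_finite _ generateFrom_cylinder isPiSystem_cylinder ?_ (by simp)
  rintro _ ⟨f, n, rfl⟩
  rw [h, coinMeasure_cylinder]

/-- The set of branches is closed: leaving it is witnessed by a finite initial segment. -/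
theorem exists_cylinder_disjoint_branches {T : Set (List Bool)} {f : ℕ → Bool}
    (hf : f ∉ branches T) : ∃ n, ∀ g ∈ PiNat.cylinder f n, g ∉ branches T := by
  simp only [branches, Set.mem_ofPred_eq, not_forall] at hf
  obtain ⟨n, hn⟩ := hf
  refine ⟨n, fun g hg hT => hn ?_⟩
  convert hT n using 3 with i
  exact (hg i i.2).symm

theorem measurableSet_branches (T : Set (List Bool)) : MeasurableSet (branches T) := by
  refine IsClosed.measurableSet (isOpen_compl_iff.1 (isOpen_iff_mem_nhds.2 fun f hf => ?_))
  obtain ⟨n, hn⟩ := exists_cylinder_disjoint_branches hf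
  exact Filter.mem_of_superset
    ((PiNat.isOpen_cylinder _ f n).mem_nhds (PiNat.self_mem_cylinder f n)) hn

/-! ### Binary digits of the elements of a hyperfinite set -/

namespace NonstandardUniverse

open Superstructure

variable {U : NonstandardUniverse.{u}} {H : U.Ext} {κ : Cardinal.{u}}

open Classical in
variable (U H) in
/-- The sequence of the standard binary digits of an element of `Ω`. -/
noncomputable def digits (ω : U.Omega H) (n : ℕ) : Bool :=
  decide (Elem ω.1 (U.star (natSet {k | k.testBit n = true})))

/-- Finitely many standard digits are read off the star of a single standard set, so cylinders pull
back to internal sets. -/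
theorem elem_star_digits_iff (f : ℕ → Bool) (n : ℕ) (ω : U.Omega H) :
    Elem ω.1 (U.star (natSet {k | ∀ i < n, k.testBit i = f i})) ↔
      U.digits H ω ∈ PiNat.cylinder f n := by
  induction n with
  | zero => simpa using elem_star_univ ω.1 ω.2.1
  | succ n ih =>
    have e : {k : ℕ | ∀ i < n + 1, k.testBit i = f i} =
        {k | ∀ i < n, k.testBit i = f i} ∩ {k | k.testBit n = f n} := by
      ext k
      simp only [Set.mem_ofPred_eq, Set.mem_inter_iff, Nat.forall_lt_succ_right]
    rw [e, elem_star_inter, ih]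
    simp only [PiNat.mem_cylinder_iff, Nat.forall_lt_succ_right]
    refine and_congr_right fun _ => ?_
    cases hf : f n with
    | true => simp [digits]
    | false =>
      have e' : {k : ℕ | k.testBit n = false} = {k | k.testBit n = true}ᶜ := by
        ext k
        simp
      rw [e', elem_star_compl _ _ ω.2.1]
      simp [digits]

/-- Reduces the measure of cylinders to the frequency of residue classes modulo 2^n. -/
theorem setOf_testBit_eq (f : ℕ → Bool) (n : ℕ) :
    ∃ m < 2 ^ n, {k : ℕ | ∀ i < n, k.testBit i = f i} = {k | k % 2 ^ n = m} := by
  refine ⟨Nat.ofBits fun i : Fin n => f i, Nat.ofBits_lt_two_pow _, Set.ext fun k => ?_⟩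
  constructor
  · intro h
    refine Nat.eq_of_testBit_eq fun i => ?_
    rw [Nat.testBit_mod_two_pow]
    by_cases hi : i < n
    · rw [Nat.testBit_ofBits_lt _ _ hi]
      simp [hi, h i hi]
    · rw [Nat.testBit_ofBits_ge _ _ (not_lt.1 hi)]
      simp [hi]
  · intro (h : k % 2 ^ n = _) i hi
    have := Nat.testBit_ofBits_lt (fun i : Fin n => f i) i hi
    rw [← h, Nat.testBit_mod_two_pow] at this
    simpa [hi] using this

theorem IsHyperfiniteInteger.exists_digits_cylinder (hH : U.IsHyperfiniteInteger H)
    (f : ℕ → Bool) (n : ℕ) :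
    ∃ A ∈ U.internalPowerset H, U.stProb H A = (2 ^ n)⁻¹ ∧
      ∀ ω : U.Omega H, Elem ω.1 A ↔ U.digits H ω ∈ PiNat.cylinder f n := by
  obtain ⟨B, hB, hB'⟩ := exists_omega_mem hH
  obtain ⟨A, hA, hA'⟩ := exists_inter_mem hB (star_natSet_elem {k | ∀ i < n, k.testBit i = f i})
  obtain ⟨m, hm, e⟩ := setOf_testBit_eq f n
  refine ⟨A, hA, ?_, fun ω => ?_⟩
  · have := hH.stProb_mod hA hm fun x => by rw [hA', hB', e]
    simpa using this
  · rw [hA', hB', elem_star_digits_iff]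
    exact and_iff_right ω.2

theorem IsHyperfiniteInteger.measurable_digits (hH : U.IsHyperfiniteInteger H) :
    Measurable (U.digits H) := by
  rw [generateFrom_cylinder]
  refine measurable_generateFrom ?_
  rintro _ ⟨f, n, rfl⟩
  obtain ⟨A, hA, -, h⟩ := hH.exists_digits_cylinder f n
  have e : U.digits H ⁻¹' PiNat.cylinder f n = U.toSet A := Set.ext fun ω => (h ω).symm
  rw [e]
  exact hH.measurableSet_toSet hA

theorem IsHyperfiniteInteger.map_digits (hH : U.IsHyperfiniteInteger H)
    (hU : U.IsSaturated κ) (hκ : ℵ₀ < κ) : (U.loebMeasure H).map (U.digits H) = coinMeasure := by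
  have := hH.isProbabilityMeasure_loebMeasure hU hκ
  have := Measure.isProbabilityMeasure_map (μ := U.loebMeasure H) hH.measurable_digits.aemeasurable
  refine eq_coinMeasure fun f n => ?_
  obtain ⟨A, hA, hP, h⟩ := hH.exists_digits_cylinder f n
  have e : U.digits H ⁻¹' PiNat.cylinder f n = U.toSet A := Set.ext fun ω => (h ω).symm
  rw [Measure.map_apply hH.measurable_digits (PiNat.isOpen_cylinder _ f n).measurableSet, e,
    hH.loebMeasure_toSet hU hκ hA, hP, ENNReal.ofReal_inv_of_pos (by positivity),
    ENNReal.ofReal_pow (by positivity)]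
  simp

/-! ### The compact family -/

/-- The countable intersections of sets `A α ∩ digits⁻¹ [T α n]`. -/
def treeFamily {ι : Type*} (T : ι → ℕ → Set (List Bool)) (A : ι → U.Ext) :
    Set (Set (U.Omega H)) :=
  {K | ∃ (a : ℕ → ι) (m : ℕ → ℕ),
    K = ⋂ j, U.toSet (A (a j)) ∩ U.digits H ⁻¹' branches (T (a j) (m j))}

theorem IsHyperfiniteInteger.measurableSet_treeFamily (hH : U.IsHyperfiniteInteger H)
    {ι : Type*} {T : ι → ℕ → Set (List Bool)} {A : ι → U.Ext}
    (hA : ∀ α, A α ∈ U.internalPowerset H) {K : Set (U.Omega H)} (hK : K ∈ treeFamily T A) :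
    MeasurableSet K := by
  obtain ⟨a, m, rfl⟩ := hK
  exact MeasurableSet.iInter fun j => (hH.measurableSet_toSet (hA _)).inter
    (hH.measurable_digits (measurableSet_branches _))

theorem IsHyperfiniteInteger.isCompactFamily_treeFamily (hH : U.IsHyperfiniteInteger H)
    (hU : U.IsSaturated κ) (hκ : ℵ₀ < κ) {ι : Type u} {T : ι → ℕ → Set (List Bool)}
    (hT : ∀ f : ℕ → Bool, #{α | ∃ n, f ∈ branches (T α n)} < κ) {A : ι → U.Ext}
    (hA : ∀ α, A α ∈ U.internalPowerset H) :
    IsCompactFamily (treeFamily T A : Set (Set (U.Omega H))) := by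
  intro D hD hfip
  have hne : (Filter.generate D).NeBot := Filter.generate_neBot_iff.2 fun t ht hf => hfip t ht hf
  let F : Ultrafilter (U.Omega H) := Ultrafilter.of (Filter.generate D)
  have hDF : ∀ K ∈ D, K ∈ F := fun K hK =>
    Ultrafilter.of_le (Filter.generate D) (Filter.mem_generate_of_mem hK)
  classical
  -- The limit of the digits along the ultrafilter, which decides each coordinate.
  let f : ℕ → Bool := fun i => decide (∀ᶠ ω in (F : Filter _), U.digits H ω i = true)
  have hf : ∀ n, ∀ᶠ ω in (F : Filter _), U.digits H ω ∈ PiNat.cylinder f n := by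
    intro n
    simp only [PiNat.mem_cylinder_iff]
    refine (Set.finite_Iio n).eventually_all.2 fun i _ => ?_
    by_cases hi : ∀ᶠ ω in (F : Filter _), U.digits H ω i = true
    · exact hi.mono fun ω h => h.trans (decide_eq_true hi).symm
    · refine (Ultrafilter.eventually_not.2 hi).mono fun ω h => ?_
      simpa only [f, hi, decide_false, Bool.not_eq_true] using h
  choose C hC _ hCf using hH.exists_digits_cylinder f
  -- The first condition keeps S smaller than κ by the witness property; the second gives the finite
  -- intersection property.
  let S : Set ι := {α | (∃ n, f ∈ branches (T α n)) ∧ U.toSet (A α) ∈ F}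
  have hS : #S < κ := (mk_le_mk_of_subset fun α hα => hα.1).trans_lt (hT f)
  obtain ⟨ω, hω⟩ := hU.exists_forall_mem (H := H) (F := A '' S ∪ Set.range C)
    (by
      rintro _ (⟨α, -, rfl⟩ | ⟨n, rfl⟩)
      exacts [hA α, hC n])
    ((mk_union_le _ _).trans_lt (add_lt_of_lt hκ.le (mk_image_le.trans_lt hS)
      ((Set.countable_range C).le_aleph0.trans_lt hκ)))
    ⟨C 0, Or.inr ⟨0, rfl⟩⟩ fun G hG hfin => by
      have : ∀ᶠ ω in (F : Filter (U.Omega H)), ∀ B ∈ G, Elem ω.1 B := by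
        refine hfin.eventually_all.2 fun B hB => ?_
        obtain ⟨α, hα, rfl⟩ | ⟨n, rfl⟩ := hG hB
        · exact hα.2
        · exact (hf n).mono fun ω h => (hCf n ω).2 h
      exact this.exists
  have hωf : U.digits H ω = f := by
    ext n
    exact (hCf (n + 1) ω).1 (hω _ (Or.inr ⟨n + 1, rfl⟩)) n n.lt_succ_self
  refine ⟨ω, fun K hK => ?_⟩
  obtain ⟨a, m, rfl⟩ := hD hK
  have hKF := hDF _ hK
  refine Set.mem_iInter.2 fun j => ?_
  have hj := Filter.mem_of_superset hKF (Set.iInter_subset _ j)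
  -- Otherwise a cylinder around f misses the branches, although both preimages belong to the
  -- ultrafilter.
  have hfT : f ∈ branches (T (a j) (m j)) := by
    by_contra hn
    obtain ⟨n, hn⟩ := exists_cylinder_disjoint_branches hn
    obtain ⟨ω', h1, h2⟩ := ((hf n).and hj).exists
    exact hn _ h1 h2.2
  exact ⟨hω _ (Or.inl ⟨a j, ⟨⟨m j, hfT⟩, Filter.mem_of_superset hj Set.inter_subset_left⟩, rfl⟩),
    by rw [Set.mem_preimage, hωf]; exact hfT⟩

/-! ### Inner regularity -/

theorem IsHyperfiniteInteger.loebMeasure_compl_branches_le (hH : U.IsHyperfiniteInteger H)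
    (hU : U.IsSaturated κ) (hκ : ℵ₀ < κ) {T : ℕ → Set (List Bool)}
    (hT : ∀ n : ℕ, (n : ℝ) / (n + 1) < coinMeasure.real (branches (T n))) {δ : ℝ≥0∞}
    (hδ : 0 < δ) : ∃ n, U.loebMeasure H (U.digits H ⁻¹' branches (T n))ᶜ ≤ δ := by
  have : IsProbabilityMeasure coinMeasure := by unfold coinMeasure; infer_instance
  obtain ⟨n, hn⟩ := ENNReal.exists_inv_nat_lt hδ.ne'
  refine ⟨n, le_trans ?_ hn.le⟩
  rw [← Set.preimage_compl, ← Measure.map_apply hH.measurable_digits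
    (measurableSet_branches _).compl, hH.map_digits hU hκ, ← ofReal_measureReal,
    probReal_compl_eq_one_sub (measurableSet_branches _)]
  -- For n = 0 the bound is the inverse of 0, which is ∞.
  rcases n.eq_zero_or_pos with rfl | hn0
  · simp
  rw [← ENNReal.ofReal_natCast, ← ENNReal.ofReal_inv_of_pos (by exact_mod_cast hn0)]
  refine ENNReal.ofReal_le_ofReal ?_
  have h1 : (1 : ℝ) - n / (n + 1) = (n + 1 : ℝ)⁻¹ := by field_simp; ring
  have h2 : ((n : ℝ) + 1)⁻¹ ≤ (n : ℝ)⁻¹ := by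
    have : (0 : ℝ) < n := by exact_mod_cast hn0
    gcongr
    linarith
  linarith [hT n]

theorem IsHyperfiniteInteger.exists_mem_treeFamily (hH : U.IsHyperfiniteInteger H)
    (hU : U.IsSaturated κ) (hκ : ℵ₀ < κ) {ι : Type*} {T : ι → ℕ → Set (List Bool)}
    (hT : ∀ α, ∀ n : ℕ, (n : ℝ) / (n + 1) < coinMeasure.real (branches (T α n))) {A : ι → U.Ext}
    (hA : ∀ B ∈ U.internalPowerset H, ∃ α, A α = B) (hA' : ∀ α, A α ∈ U.internalPowerset H)
    {E : Set (U.Omega H)} (hE : MeasurableSet E) {ε : ℝ≥0∞} (hε : 0 < ε) :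
    ∃ K ∈ treeFamily T A, K ⊆ E ∧ U.loebMeasure H E ≤ U.loebMeasure H K + ε := by
  have := hH.isProbabilityMeasure_loebMeasure hU hκ
  have hε2 : 0 < ε / 2 := ENNReal.half_pos hε.ne'
  -- Half of ε pays for the excess of the cover, the other half for the measure lost to the trees,
  -- shared out as δ_j.
  obtain ⟨D, hD, hcov, hsum⟩ := hH.exists_cover_of_loebMeasure_lt hE.compl
    (ENNReal.lt_add_right (measure_ne_top (U.loebMeasure H) Eᶜ) hε2.ne')
  obtain ⟨δ, hδ, hδsum⟩ := ENNReal.exists_pos_sum_of_countable' hε2.ne' ℕ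
  obtain ⟨Om, hOm, hOm'⟩ := exists_omega_mem hH
  choose B hB hB' using fun j => exists_diff_mem hOm (mem_internalPowerset.1 (hD j)).1
  choose a ha using fun j => hA (B j) (hB j)
  choose m hm using fun j => hH.loebMeasure_compl_branches_le hU hκ (hT (a j)) (hδ j)
  have hmem : ∀ j (ω : U.Omega H), Elem ω.1 (B j) ↔ ¬ Elem ω.1 (D j) := fun j ω => by
    rw [hB', hOm']
    exact and_iff_right ω.2
  set K : Set (U.Omega H) := ⋂ j, U.toSet (A (a j)) ∩ U.digits H ⁻¹' branches (T (a j) (m j))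
    with hK
  have hKF : K ∈ treeFamily T A := ⟨a, m, rfl⟩
  have hKm := hH.measurableSet_treeFamily hA' hKF
  refine ⟨K, hKF, fun ω hω => ?_, ?_⟩
  · by_contra hωE
    obtain ⟨j, hj⟩ := Set.mem_iUnion.1 (hcov hωE)
    have := (Set.mem_iInter.1 hω j).1
    rw [ha] at this
    exact (hmem j ω).1 this hj
  · have hKc : Kᶜ ⊆ (⋃ j, U.toSet (D j)) ∪
        ⋃ j, (U.digits H ⁻¹' branches (T (a j) (m j)))ᶜ := by
      intro ω hω
      rw [hK, Set.compl_iInter] at hω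
      obtain ⟨j, hj⟩ := Set.mem_iUnion.1 hω
      rw [Set.compl_inter, ha] at hj
      rcases hj with hj | hj
      · exact Or.inl (Set.mem_iUnion.2 ⟨j, not_not.1 fun h => hj ((hmem j ω).2 h)⟩)
      · exact Or.inr (Set.mem_iUnion.2 ⟨j, hj⟩)
    have hle : U.loebMeasure H Kᶜ ≤ U.loebMeasure H Eᶜ + ε := by
      calc U.loebMeasure H Kᶜ ≤ _ := measure_mono hKc
        _ ≤ _ := measure_union_le _ _
        _ ≤ _ := add_le_add (measure_iUnion_le _) (measure_iUnion_le _)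
        _ ≤ (U.loebMeasure H Eᶜ + ε / 2) + ε / 2 := by
          refine add_le_add (le_of_eq_of_le (tsum_congr fun j => ?_) hsum.le)
            ((ENNReal.tsum_le_tsum hm).trans hδsum.le)
          exact hH.loebMeasure_toSet hU hκ (hD j)
        _ = U.loebMeasure H Eᶜ + ε := by rw [add_assoc, ENNReal.add_halves]
    -- The bound on complements is turned around by adding the finite measure of Eᶜ, which avoids
    -- subtraction in `ℝ≥0∞`.
    refine (ENNReal.add_le_add_iff_right (measure_ne_top (U.loebMeasure H) Eᶜ)).1 ?_
    calc U.loebMeasure H E + U.loebMeasure H Eᶜ = 1 := prob_add_prob_compl hE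
      _ = U.loebMeasure H K + U.loebMeasure H Kᶜ := (prob_add_prob_compl hKm).symm
      _ ≤ U.loebMeasure H K + (U.loebMeasure H Eᶜ + ε) := by gcongr
      _ = U.loebMeasure H K + ε + U.loebMeasure H Eᶜ := by ring

end NonstandardUniverse

theorem theorem2 (U : NonstandardUniverse.{u}) (H : U.Ext) (hH : U.IsHyperfiniteInteger H)
    (κ lam : Cardinal.{u}) (hκ : ℵ₀ < κ) (hlam : ℵ₀ < lam)
    (hwitness : ∃ T : lam.ord.ToType → ℕ → Set (List Bool), IsWitness κ lam T)
    (hsaturated : U.IsSaturated κ) (hcard : #(U.internalPowerset H) = lam) :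
    IsCompactProbabilitySpace (U.loebMeasure H) := by
  obtain ⟨T, hT⟩ := hwitness
  -- Surjectivity gives every internal set a tree sequence. An index determines its internal set, so
  -- fewer than κ indices yield fewer than κ sets.
  obtain ⟨e⟩ : Nonempty (lam.ord.ToType ≃ U.internalPowerset H) := by
    rw [← Cardinal.eq, mk_ord_toType, hcard]
  let A : lam.ord.ToType → U.Ext := fun α => (e α).1
  have hA : ∀ α, A α ∈ U.internalPowerset H := fun α => (e α).2
  refine ⟨hH.isProbabilityMeasure_loebMeasure hsaturated hκ,
    NonstandardUniverse.treeFamily T A, fun K hK => hH.measurableSet_treeFamily hA hK,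
    hH.isCompactFamily_treeFamily hsaturated hκ hT.card_lt hA, fun E hE => ?_⟩
  refine le_antisymm (ENNReal.le_of_forall_pos_le_add fun ε hε _ => ?_)
    (iSup₂_le fun K hK => measure_mono hK.2)
  obtain ⟨K, hK, hKE, hle⟩ := hH.exists_mem_treeFamily hsaturated hκ hT.measure_gt (A := A)
    (fun B hB => ⟨e.symm ⟨B, hB⟩, by simp [A]⟩) hA hE (ENNReal.coe_pos.2 hε)
  refine hle.trans (add_le_add_left ?_ _)
  exact le_iSup₂_of_le (f := fun K _ => U.loebMeasure H K) K ⟨hK, hKE⟩ le_rfl
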